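/- **Setting.** Let $U\ge 2$, $V\ge 1$ and $T\ge 0$ be integers and let $\mathbb F_q$ be a finite field. Consider a network of one server, $U$ relays and $UV$ users, where user $(u,v)\in[U]\times[V]$ is connected to relay $u$ only and every relay is connected to the server. All entropies $H$ and mutual informations $I$ are in $q$-ary units. A *secure aggregation scheme* of input length $L\ge1$ consists of finite-valued random variables on a common probability space: inputs $W_{u,v}$, individual keys $Z_{u,v}$ and messages $X_{u,v}$ for $(u,v)\in[U]\times[V]$, messages $Y_u$ for $u\in[U]$, and a source key $Z_\Sigma$, such that the following hold. Write $W=(W_{u,v})_{u,v}$, $Z=(Z_{u,v})_{u,v}$ and $S=\sum_{u,v}W_{u,v}$. 1. Each $W_{u,v}$ is uniformly distributed on $\mathbb F_q^L$; the inputs are independent of each other and of the keys, i.e. $H(Z,W)=H(Z)+\sum_{u,v}H(W_{u,v})$; and $H(Z\mid Z_\Sigma)=0$. 2. $H(X_{u,v}\mid W_{u,v},Z_{u,v})=0$ for all $(u,v)$, and $H(Y_u\mid (X_{u,v})_{v\in[V]})=0$ for all $u$. 3. (Correctness) $H(S\mid Y_1,\dots,Y_U)=0$. 4. (Relay security) $I\big((X_{u,v})_{v\in[V]};W\,\big|\,(W_{i,j},Z_{i,j})_{(i,j)\in\mathcal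 T}\big)=0$ for all $u\in[U]$ and all $\mathcal T\subseteq[U]\times[V]$ with $|\mathcal T|\le T$. 5. (Server security) $I\big(Y_1,\dots,Y_U;W\,\big|\,S,(W_{i,j},Z_{i,j})_{(i,j)\in\mathcal T}\big)=0$ for all $\mathcal T\subseteq[U]\times[V]$ with $|\mathcal T|\le T$. A tuple $(R_X,R_Y,R_Z,R_{Z_\Sigma})\in\mathbb R^4$ is *achievable* if, for some $L\ge1$, there is a secure aggregation scheme of input length $L$ with $H(X_{u,v})\le R_XL$, $H(Y_u)\le R_YL$ and $H(Z_{u,v})\le R_ZL$ for all $u,v$, and $H(Z_\Sigma)\le R_{Z_\Sigma}L$. The *optimal rate region* $\mathcal R^*$ is the closure in $\mathbb R^4$ of the set of achievable tuples. **Theorem 1.** If $T\ge(U-1)V$, then $\mathcal R^*=\emptyset$. If $T<(U-1)V$, then $$\mathcal R^*=\Big\{(R_X,R_Y,R_Z,R_{Z_\Sigma})\in\mathbb R^4:\ R_X\ge1,\ R_Y\ge1,\ R_Z\ge1,\ R_{Z_\Sigma}\ge\max\{V+T,\min\{UV-1,U+T-1\}\}\Big\}.$$ -/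

import Mathlib

open MeasureTheory

namespace HSA

noncomputable section

section Entropy

variable {Ω : Type} [MeasurableSpace Ω]

/-- Shannon entropy `H(X)`, in `q`-ary units, of a random variable with values in a finite set. -/
def entropy (q : ℕ) (P : Measure Ω) {α : Type} [Fintype α] (X : Ω → α) : ℝ :=
  (∑ x : α, Real.negMulLog (P.real (X ⁻¹' {x}))) / Real.log q

/-- Conditional entropy `H(X | Y) = H(X, Y) - H(Y)`. -/
def condEntropy (q : ℕ) (P : Measure Ω) {α β : Type} [Fintype α] [Fintype β]
    (X : Ω → α) (Y : Ω → β) : ℝ :=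
  entropy q P (fun ω => (X ω, Y ω)) - entropy q P Y

/-- Conditional mutual information `I(X ; Y | Z) = H(X | Z) - H(X | Y, Z)`. -/
def condMutualInfo (q : ℕ) (P : Measure Ω) {α β γ : Type} [Fintype α] [Fintype β] [Fintype γ]
    (X : Ω → α) (Y : Ω → β) (Z : Ω → γ) : ℝ :=
  condEntropy q P X Z - condEntropy q P X (fun ω => (Y ω, Z ω))

/-- A random variable with values in a set carrying the discrete `σ`-algebra. -/
def IsDiscreteRV {α : Type} (X : Ω → α) : Prop :=
  @Measurable Ω α _ ⊤ X

end Entropy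

/-- The random variables of a hierarchical network with `U` relays and `V` users per relay, on some
probability space: the inputs `W`, vectors of `L` symbols of `F`, the source key `ZS`, the
individual keys `Z`, the user-to-relay messages `X` and the relay-to-server messages `Y`. User
`(u, v)` is the `v`-th user of relay `u`. Keys and messages have arbitrary finite alphabets. -/
structure Network (F : Type) [Field F] [Fintype F] (U V L : ℕ) where
  Ω : Type
  [mΩ : MeasurableSpace Ω]
  P : Measure Ω
  [prob : IsProbabilityMeasure P]
  AZS : Type
  AZ : Type
  AX : Type
  AY : Type
  [finZS : Fintype AZS]
  [finZ : Fintype AZ]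
  [finX : Fintype AX]
  [finY : Fintype AY]
  W : Fin U × Fin V → Ω → (Fin L → F)
  ZS : Ω → AZS
  Z : Fin U × Fin V → Ω → AZ
  X : Fin U × Fin V → Ω → AX
  Y : Fin U → Ω → AY
  meas_W : ∀ i, IsDiscreteRV (W i)
  meas_ZS : IsDiscreteRV ZS
  meas_Z : ∀ i, IsDiscreteRV (Z i)
  meas_X : ∀ i, IsDiscreteRV (X i)
  meas_Y : ∀ u, IsDiscreteRV (Y u)

namespace Network

attribute [instance] mΩ prob finZS finZ finX finY

variable {F : Type} [Field F] [Fintype F] {U V L : ℕ} (N : Network F U V L)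

/-- Entropy in units of symbols of `F`. -/
def H {α : Type} [Fintype α] (A : N.Ω → α) : ℝ :=
  entropy (Fintype.card F) N.P A

/-- Conditional entropy in units of symbols of `F`. -/
def condH {α β : Type} [Fintype α] [Fintype β] (A : N.Ω → α) (B : N.Ω → β) : ℝ :=
  condEntropy (Fintype.card F) N.P A B

/-- Conditional mutual information in units of symbols of `F`. -/
def condI {α β γ : Type} [Fintype α] [Fintype β] [Fintype γ]
    (A : N.Ω → α) (B : N.Ω → β) (C : N.Ω → γ) : ℝ :=
  condMutualInfo (Fintype.card F) N.P A B C

/-- All inputs, jointly. -/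
def allW (ω : N.Ω) : Fin U × Fin V → (Fin L → F) := fun i => N.W i ω

/-- All individual keys, jointly. -/
def allZ (ω : N.Ω) : Fin U × Fin V → N.AZ := fun i => N.Z i ω

/-- The messages received by relay `u`, jointly. -/
def relayX (u : Fin U) (ω : N.Ω) : Fin V → N.AX := fun v => N.X (u, v) ω

/-- The messages received by the server, jointly. -/
def allY (ω : N.Ω) : Fin U → N.AY := fun u => N.Y u ω

/-- The sum of all inputs. -/
def sumW (ω : N.Ω) : Fin L → F := ∑ i, N.W i ω

/-- The inputs and individual keys of the users in `S`, jointly. -/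
def collusion (S : Finset (Fin U × Fin V)) (ω : N.Ω) : S → (Fin L → F) × N.AZ :=
  fun i => (N.W i ω, N.Z i ω)

/-- The random variables form a secure aggregation scheme that withstands collusion with up to `T`
users. -/
structure IsSecureScheme (T : ℕ) : Prop where
  /-- Every input is uniformly distributed on `F ^ L`. -/
  uniform : ∀ i, ∀ w : Fin L → F,
    N.P.real (N.W i ⁻¹' {w}) = 1 / (Fintype.card F : ℝ) ^ L
  /-- The inputs are independent of each other and of the individual keys. -/
  indep : N.H (fun ω => (N.allZ ω, N.allW ω)) = N.H N.allZ + ∑ i, N.H (N.W i)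
  /-- The individual keys are generated from the source key. -/
  key_generation : N.condH N.allZ N.ZS = 0
  /-- Each user's message is a function of the user's input and key. -/
  user_message : ∀ i, N.condH (N.X i) (fun ω => (N.W i ω, N.Z i ω)) = 0
  /-- Each relay's message is a function of the messages of the users of this relay. -/
  relay_message : ∀ u, N.condH (N.Y u) (N.relayX u) = 0
  /-- The server recovers the sum of the inputs. -/
  correctness : N.condH N.sumW N.allY = 0
  /-- A relay that colludes with at most `T` users learns nothing about the inputs. -/
  relay_security : ∀ u, ∀ S : Finset (Fin U × Fin V), S.card ≤ T →
    N.condI (N.relayX u) N.allW (N.collusion S) = 0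
  /-- The server, colluding with at most `T` users, learns nothing beyond the sum. -/
  server_security : ∀ S : Finset (Fin U × Fin V), S.card ≤ T →
    N.condI N.allY N.allW (fun ω => (N.sumW ω, N.collusion S ω)) = 0

end Network

/-- The rate tuple `(R_X, R_Y, R_Z, R_ZΣ)` is achievable: for some input length `L ≥ 1` there is a
secure scheme whose user messages, relay messages, individual keys and source key have at most
`R_X`, `R_Y`, `R_Z` and `R_ZΣ` symbols per input symbol. -/
def Achievable (F : Type) [Field F] [Fintype F] (U V T : ℕ) (R : ℝ × ℝ × ℝ × ℝ) : Prop :=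
  ∃ L : ℕ, 1 ≤ L ∧ ∃ N : Network F U V L, N.IsSecureScheme T ∧
    (∀ i, N.H (N.X i) / L ≤ R.1) ∧
    (∀ u, N.H (N.Y u) / L ≤ R.2.1) ∧
    (∀ i, N.H (N.Z i) / L ≤ R.2.2.1) ∧
    N.H N.ZS / L ≤ R.2.2.2

/-- The optimal rate region: the closure of the set of achievable rate tuples. -/
def optimalRateRegion (F : Type) [Field F] [Fintype F] (U V T : ℕ) : Set (ℝ × ℝ × ℝ × ℝ) :=
  closure {R | Achievable F U V T R}

end

end HSA

/-! Converse. Joint entropies form a polymatroid, so the bounds are submodularity arguments. Given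
the inputs and keys of all users but one, that user's input still has entropy `L`, and the sum
reveals it. Hence each user or relay message that carries it has conditional entropy at least `L`,
which gives `R_X, R_Y ≥ 1`. Relay security keeps this uncertainty when all inputs are also given,
and then only keys can supply it: a key has entropy at least `L` given any `T` other keys
(`key_step`). The same argument for all `V` messages of a relay, against `T` colluders outside it,
gives `V + T` (`relay_source_bound`). For the server, the `U` relay messages, less the one sum it
may learn, against colluders that spare a user in every relay, give `U + |C| - 1`
(`server_source_bound`). If all users outside one relay may collude, that relay can compute the sum,
which contradicts security.

Achievability. Take `L = UV - 1`, let `K` be the extension of `F` of degree `L`, and choose points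
`α i` in `K` whose only `F`-linear relation is `∑ α i = 0`. The source key is a random linearized
polynomial `f` with `m` coefficients in `K`, where `m` is the lower bound on `R_ZΣ`. User `i` sends
its input plus `f (α i)`, and relays add. Since `f` is `F`-linear, the keys cancel in the total.
Security holds because such `f` interpolate every linear map on a subspace of dimension at most `m`
(`exists_linearizedEval_eq`): whatever the inputs compatible with the conditioning, some `f` makes
the observed messages zero. -/

namespace HSA

noncomputable section

/-! ### Shannon entropy of finite-valued random variables -/

section EntropyBasics

/-- The Gibbs inequality. -/
lemma sum_negMulLog_le {ι : Type*} (s : Finset ι) (p r : ι → ℝ) (hp : ∀ i ∈ s, 0 ≤ p i)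
    (hr : ∀ i ∈ s, 0 ≤ r i) (hpr : ∀ i ∈ s, r i = 0 → p i = 0)
    (hsum : ∑ i ∈ s, r i ≤ ∑ i ∈ s, p i) :
    ∑ i ∈ s, Real.negMulLog (p i) ≤ ∑ i ∈ s, -(p i * Real.log (r i)) := by
  -- This is `log x ≤ x - 1` at `x = r i / p i`; the slack `r i - p i` has nonpositive sum.
  have key : ∀ i ∈ s, Real.negMulLog (p i) ≤ -(p i * Real.log (r i)) + (r i - p i) := by
    intro i hi
    rcases (hp i hi).eq_or_lt with h0 | hpos
    · simp [← h0, hr i hi]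
    · have hrpos : 0 < r i :=
        lt_of_le_of_ne (hr i hi) fun h => hpos.ne' (hpr i hi h.symm)
      have h1 := Real.log_le_sub_one_of_pos (div_pos hrpos hpos)
      rw [Real.log_div hrpos.ne' hpos.ne'] at h1
      have h2 := mul_le_mul_of_nonneg_left h1 hpos.le
      have h3 : p i * (r i / p i - 1) = r i - p i := by field_simp
      rw [h3] at h2
      simp only [Real.negMulLog]
      linarith
  calc ∑ i ∈ s, Real.negMulLog (p i)
      ≤ ∑ i ∈ s, (-(p i * Real.log (r i)) + (r i - p i)) := Finset.sum_le_sum key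
    _ ≤ _ := by rw [Finset.sum_add_distrib, Finset.sum_sub_distrib]; linarith

variable {Ω : Type} [MeasurableSpace Ω] {P : Measure Ω}

variable {α β γ : Type} [Fintype α] [Fintype β] [Fintype γ]

/-- Entropy depends only on the partition of `Ω` into fibres. -/
lemma entropy_congr {q : ℕ} {X : Ω → α} {Y : Ω → β}
    (h : ∀ ω ω', X ω = X ω' ↔ Y ω = Y ω') : entropy q P X = entropy q P Y := by
  classical
  unfold entropy
  congr 1
  -- Values that are not attained contribute `negMulLog 0 = 0`, so only attained values need
  -- matching.
  have ne : ∀ {δ : Type} (D : Ω → δ) (d : δ),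
      Real.negMulLog (P.real (D ⁻¹' {d})) ≠ 0 → ∃ ω, D ω = d := by
    intro δ D d hd
    by_contra hcon
    push Not at hcon
    apply hd
    have : D ⁻¹' {d} = ∅ := by ext ω; simp [hcon ω]
    simp [this]
  have fib : ∀ ω, X ⁻¹' {X ω} = Y ⁻¹' {Y ω} := by
    intro ω; ext ω'; simpa using h ω' ω
  refine Finset.sum_bij_ne_zero (fun x _ hx => Y (ne X x hx).choose) (fun _ _ _ => Finset.mem_univ _)
    ?_ ?_ ?_
  · intro x₁ _ h₁ x₂ _ h₂ he
    rw [← (ne X x₁ h₁).choose_spec, ← (ne X x₂ h₂).choose_spec]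
    exact (h _ _).2 he
  · intro y _ hy
    obtain ⟨ω, rfl⟩ := ne Y y hy
    have hx : Real.negMulLog (P.real (X ⁻¹' {X ω})) ≠ 0 := by rwa [fib]
    exact ⟨X ω, Finset.mem_univ _, hx, (h _ _).1 (ne X (X ω) hx).choose_spec⟩
  · intro x _ hx
    conv_lhs => rw [← (ne X x hx).choose_spec, fib]

lemma IsDiscreteRV.measurableSet_preimage {α : Type} {X : Ω → α} (hX : IsDiscreteRV X) (s : Set α) :
    MeasurableSet (X ⁻¹' s) :=
  @hX s trivial

lemma isDiscreteRV_of_fibres {X : Ω → α} (hX : ∀ x, MeasurableSet (X ⁻¹' {x})) :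
    IsDiscreteRV X := by
  intro s _
  have : X ⁻¹' s = ⋃ x ∈ s, X ⁻¹' {x} := by ext ω; simp
  rw [this]
  exact MeasurableSet.biUnion s.to_countable fun x _ => hX x

lemma IsDiscreteRV.prodMk {X : Ω → α} {Y : Ω → β} (hX : IsDiscreteRV X) (hY : IsDiscreteRV Y) :
    IsDiscreteRV fun ω => (X ω, Y ω) := by
  refine isDiscreteRV_of_fibres fun x => ?_
  have : (fun ω => (X ω, Y ω)) ⁻¹' {x} = X ⁻¹' {x.1} ∩ Y ⁻¹' {x.2} := by
    ext ω; simp [Prod.ext_iff]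
  rw [this]
  exact (hX.measurableSet_preimage _).inter (hY.measurableSet_preimage _)

lemma IsDiscreteRV.pi {ι : Type} [Fintype ι] [DecidableEq ι] {X : ι → Ω → α}
    (hX : ∀ i, IsDiscreteRV (X i)) : IsDiscreteRV fun ω i => X i ω := by
  refine isDiscreteRV_of_fibres fun x => ?_
  have : (fun ω i => X i ω) ⁻¹' {x} = ⋂ i, X i ⁻¹' {x i} := by
    ext ω; simp [funext_iff]
  rw [this]
  exact MeasurableSet.iInter fun i => (hX i).measurableSet_preimage _

lemma IsDiscreteRV.comp {α β : Type} {X : Ω → α} (hX : IsDiscreteRV X) (f : α → β) :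
    IsDiscreteRV fun ω => f (X ω) :=
  fun s _ => hX.measurableSet_preimage (f ⁻¹' s)

variable [IsProbabilityMeasure P]

/-- The law of `Y` is the marginal of the law of `(X, Y)`. -/
lemma sum_real_preimage_prod {X : Ω → α} {Y : Ω → β} (hX : IsDiscreteRV X) (hY : IsDiscreteRV Y)
    (y : β) : ∑ x, P.real ((fun ω => (X ω, Y ω)) ⁻¹' {(x, y)}) = P.real (Y ⁻¹' {y}) := by
  have hU : Y ⁻¹' {y} = ⋃ x : α, (fun ω => (X ω, Y ω)) ⁻¹' {(x, y)} := by
    ext ω; simp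
  rw [hU, measureReal_iUnion_fintype]
  · intro x x' hne
    rw [Function.onFun, Set.disjoint_left]
    intro ω h1 h2
    simp only [Set.mem_preimage, Set.mem_singleton_iff, Prod.mk.injEq] at h1 h2
    exact hne (h1.1.symm.trans h2.1)
  · exact fun x => (hX.prodMk hY).measurableSet_preimage _

lemma sum_real_preimage {X : Ω → α} (hX : IsDiscreteRV X) :
    ∑ x, P.real (X ⁻¹' {x}) = 1 := by
  have hU : (Set.univ : Set Ω) = ⋃ x : α, X ⁻¹' {x} := by ext ω; simp
  rw [← measureReal_iUnion_fintype, ← hU]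
  · simp
  · intro x x' hne
    rw [Function.onFun, Set.disjoint_left]
    intro ω h1 h2
    exact hne (h1.symm.trans h2)
  · exact fun x => hX.measurableSet_preimage _

lemma entropy_le_entropy_prod {q : ℕ} {X : Ω → α} {Y : Ω → β} (hX : IsDiscreteRV X)
    (hY : IsDiscreteRV Y) : entropy q P Y ≤ entropy q P fun ω => (X ω, Y ω) := by
  unfold entropy
  refine div_le_div_of_nonneg_right ?_ (Real.log_natCast_nonneg q)
  rw [Fintype.sum_prod_type_right]
  refine Finset.sum_le_sum fun y _ => ?_
  have hm := sum_real_preimage_prod (P := P) hX hY y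
  have h1 : Real.negMulLog (P.real (Y ⁻¹' {y})) = ∑ x,
      -(P.real ((fun ω => (X ω, Y ω)) ⁻¹' {(x, y)}) * Real.log (P.real (Y ⁻¹' {y}))) := by
    rw [Finset.sum_neg_distrib, ← Finset.sum_mul, hm, Real.negMulLog, neg_mul]
  rw [h1]
  refine Finset.sum_le_sum fun x _ => ?_
  set a := P.real ((fun ω => (X ω, Y ω)) ⁻¹' {(x, y)})
  have ha0 : 0 ≤ a := measureReal_nonneg
  have hab : a ≤ P.real (Y ⁻¹' {y}) := by
    rw [← hm]
    exact Finset.single_le_sum (f := fun x => P.real ((fun ω => (X ω, Y ω)) ⁻¹' {(x, y)}))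
      (fun _ _ => measureReal_nonneg) (Finset.mem_univ x)
  rcases ha0.eq_or_lt with h0 | hpos
  · simp [← h0]
  · rw [Real.negMulLog, neg_mul]
    exact neg_le_neg (mul_le_mul_of_nonneg_left (Real.log_le_log hpos hab) ha0)

lemma entropy_le_log_card {q : ℕ} {X : Ω → α} (hX : IsDiscreteRV X) :
    entropy q P X ≤ Real.log (Fintype.card α) / Real.log q := by
  unfold entropy
  refine div_le_div_of_nonneg_right ?_ (Real.log_natCast_nonneg q)
  have hs := sum_real_preimage (P := P) hX
  have hne : Nonempty α := by
    by_contra h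
    rw [not_nonempty_iff] at h
    simp at hs
  have hc : (0 : ℝ) < Fintype.card α := by exact_mod_cast Fintype.card_pos
  have := sum_negMulLog_le Finset.univ (fun x => P.real (X ⁻¹' {x}))
    (fun _ => (Fintype.card α : ℝ)⁻¹) (fun _ _ => measureReal_nonneg)
    (fun _ _ => by positivity) (fun _ _ h => by simp at h)
    (by rw [hs]; simp [hc.ne'])
  refine this.trans (le_of_eq ?_)
  rw [Finset.sum_neg_distrib, ← Finset.sum_mul, hs, Real.log_inv]
  ring

/-- Submodularity of entropy: `H(X, Y, Z) + H(Z) ≤ H(X, Z) + H(Y, Z)`. -/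
lemma entropy_submodular {q : ℕ} {X : Ω → α} {Y : Ω → β} {Z : Ω → γ} (hX : IsDiscreteRV X)
    (hY : IsDiscreteRV Y) (hZ : IsDiscreteRV Z) :
    entropy q P (fun ω => (X ω, Y ω, Z ω)) + entropy q P Z
      ≤ entropy q P (fun ω => (X ω, Z ω)) + entropy q P fun ω => (Y ω, Z ω) := by
  unfold entropy
  rw [← add_div, ← add_div]
  refine div_le_div_of_nonneg_right ?_ (Real.log_natCast_nonneg q)
  set p : α × β × γ → ℝ := fun t => P.real ((fun ω => (X ω, Y ω, Z ω)) ⁻¹' {t}) with hp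
  set a : α × γ → ℝ := fun t => P.real ((fun ω => (X ω, Z ω)) ⁻¹' {t}) with ha
  set b : β × γ → ℝ := fun t => P.real ((fun ω => (Y ω, Z ω)) ⁻¹' {t}) with hb
  set c : γ → ℝ := fun t => P.real (Z ⁻¹' {t}) with hc
  have hp0 : ∀ t, 0 ≤ p t := fun _ => measureReal_nonneg
  have ha0 : ∀ t, 0 ≤ a t := fun _ => measureReal_nonneg
  have hb0 : ∀ t, 0 ≤ b t := fun _ => measureReal_nonneg
  have hc0 : ∀ t, 0 ≤ c t := fun _ => measureReal_nonneg
  have hpb : ∀ y z, ∑ x, p (x, y, z) = b (y, z) := fun y z =>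
    sum_real_preimage_prod hX (hY.prodMk hZ) (y, z)
  have hpa : ∀ x z, ∑ y, p (x, y, z) = a (x, z) := by
    intro x z
    have := sum_real_preimage_prod (P := P) hY (hX.prodMk hZ) (x, z)
    refine Eq.trans ?_ this
    refine Finset.sum_congr rfl fun y _ => ?_
    show P.real _ = P.real _
    congr 1
    ext ω
    simp only [Set.mem_preimage, Set.mem_singleton_iff, Prod.mk.injEq]
    tauto
  have hac : ∀ z, ∑ x, a (x, z) = c z := sum_real_preimage_prod hX hZ
  have hbc : ∀ z, ∑ y, b (y, z) = c z := sum_real_preimage_prod hY hZ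
  have hp1 : ∑ t, p t = 1 := sum_real_preimage (hX.prodMk (hY.prodMk hZ))
  have hc1 : ∑ t, c t = 1 := sum_real_preimage hZ
  have hple_a : ∀ x y z, p (x, y, z) ≤ a (x, z) := fun x y z => by
    rw [← hpa]
    exact Finset.single_le_sum (f := fun y => p (x, y, z)) (fun _ _ => hp0 _) (Finset.mem_univ y)
  have hple_b : ∀ x y z, p (x, y, z) ≤ b (y, z) := fun x y z => by
    rw [← hpb]
    exact Finset.single_le_sum (f := fun x => p (x, y, z)) (fun _ _ => hp0 _) (Finset.mem_univ x)
  have hale : ∀ x z, a (x, z) ≤ c z := fun x z => by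
    rw [← hac]
    exact Finset.single_le_sum (f := fun x => a (x, z)) (fun _ _ => ha0 _) (Finset.mem_univ x)
  have hzero : ∀ x y z, a (x, z) * b (y, z) / c z = 0 → p (x, y, z) = 0 := by
    intro x y z h
    rcases div_eq_zero_iff.1 h with h | h
    · rcases mul_eq_zero.1 h with h | h
      · exact le_antisymm (h ▸ hple_a x y z) (hp0 _)
      · exact le_antisymm (h ▸ hple_b x y z) (hp0 _)
    · exact le_antisymm ((hple_a x y z).trans (h ▸ hale x z)) (hp0 _)
  -- The comparison law `a b / c` makes `X` and `Y` independent given `Z` with the same marginals.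
  -- The Gibbs inequality against it is submodularity.
  have hr1 : ∑ t : α × β × γ, a (t.1, t.2.2) * b (t.2.1, t.2.2) / c t.2.2 = 1 := by
    rw [Fintype.sum_prod_type_right, Fintype.sum_prod_type_right, ← hc1]
    refine Finset.sum_congr rfl fun z _ => ?_
    simp only [← Finset.sum_div, ← Finset.sum_mul, ← Finset.mul_sum, hac, hbc]
    exact mul_self_div_self _
  have hG := sum_negMulLog_le Finset.univ p
    (fun t => a (t.1, t.2.2) * b (t.2.1, t.2.2) / c t.2.2) (fun _ _ => hp0 _)
    (fun _ _ => div_nonneg (mul_nonneg (ha0 _) (hb0 _)) (hc0 _))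
    (fun t _ h => hzero _ _ _ h) (by rw [hr1, hp1])
  have hsplit : ∀ t : α × β × γ,
      -(p t * Real.log (a (t.1, t.2.2) * b (t.2.1, t.2.2) / c t.2.2)) =
      -(p t * Real.log (a (t.1, t.2.2))) + -(p t * Real.log (b (t.2.1, t.2.2)))
        - -(p t * Real.log (c t.2.2)) := by
    rintro ⟨x, y, z⟩
    by_cases h0 : p (x, y, z) = 0
    · simp [h0]
    · have hr : a (x, z) * b (y, z) / c z ≠ 0 := fun h => h0 (hzero _ _ _ h)
      have h1 : c z ≠ 0 := fun h => hr (by simp [h])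
      have h2 : a (x, z) ≠ 0 := fun h => hr (by simp [h])
      have h3 : b (y, z) ≠ 0 := fun h => hr (by simp [h])
      simp only
      rw [Real.log_div (mul_ne_zero h2 h3) h1, Real.log_mul h2 h3]
      ring
  simp only [hsplit, Finset.sum_sub_distrib, Finset.sum_add_distrib] at hG
  have eA : ∑ t : α × β × γ, -(p t * Real.log (a (t.1, t.2.2))) = ∑ t, Real.negMulLog (a t) := by
    rw [Fintype.sum_prod_type, Fintype.sum_prod_type]
    refine Finset.sum_congr rfl fun x _ => ?_
    rw [Fintype.sum_prod_type_right]
    refine Finset.sum_congr rfl fun z _ => ?_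
    simp only [Finset.sum_neg_distrib, ← Finset.sum_mul, hpa, Real.negMulLog, neg_mul]
  have eB : ∑ t : α × β × γ, -(p t * Real.log (b (t.2.1, t.2.2))) = ∑ t, Real.negMulLog (b t) := by
    rw [Fintype.sum_prod_type_right]
    refine Finset.sum_congr rfl fun t _ => ?_
    simp only [Finset.sum_neg_distrib, ← Finset.sum_mul, hpb, Real.negMulLog, neg_mul]
  have eC : ∑ t : α × β × γ, -(p t * Real.log (c t.2.2)) = ∑ t, Real.negMulLog (c t) := by
    rw [Fintype.sum_prod_type_right, Fintype.sum_prod_type_right]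
    refine Finset.sum_congr rfl fun z _ => ?_
    simp only [Finset.sum_neg_distrib, ← Finset.sum_mul, hpb, hbc, Real.negMulLog, neg_mul]
  rw [eA, eB, eC] at hG
  linarith

end EntropyBasics

/-! ### Joint entropy as a polymatroid -/

section JointEntropy

variable {Ω J B : Type} [MeasurableSpace Ω] [Fintype J] [Fintype B]

open Classical in
/-- Joint entropy of the members of a family of random variables whose indices lie in `S`. -/
def jointEntropy (q : ℕ) (P : Measure Ω) (A : J → Ω → B) (S : Set J) : ℝ :=
  entropy q P fun ω (j : J) => if j ∈ S then some (A j ω) else none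

lemma restrict_eq_iff {J B : Type} (S : Set J) [DecidablePred (· ∈ S)] (f g : J → B) :
    ((fun j => if j ∈ S then some (f j) else none) = fun j => if j ∈ S then some (g j) else none) ↔
      ∀ j ∈ S, f j = g j := by
  rw [funext_iff]
  refine forall_congr' fun j => ?_
  by_cases h : j ∈ S <;> simp [h]

lemma entropy_eq_jointEntropy {q : ℕ} {P : Measure Ω} {A : J → Ω → B} {α : Type} [Fintype α]
    {X : Ω → α} (S : Set J) (h : ∀ ω ω', X ω = X ω' ↔ ∀ j ∈ S, A j ω = A j ω') :
    entropy q P X = jointEntropy q P A S := by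
  classical
  refine entropy_congr fun ω ω' => ?_
  rw [h]
  exact (restrict_eq_iff S (fun j => A j ω) fun j => A j ω').symm

lemma isDiscreteRV_restrict {A : J → Ω → B} (hA : ∀ j, IsDiscreteRV (A j)) (S : Set J)
    [DecidablePred (· ∈ S)] :
    IsDiscreteRV fun ω (j : J) => if j ∈ S then some (A j ω) else none := by
  classical
  refine IsDiscreteRV.pi fun j => ?_
  by_cases h : j ∈ S
  · simpa [h] using (hA j).comp some
  · simp only [h, if_false]
    exact fun s _ => MeasurableSet.const _

/-- A monotone submodular real set function that vanishes on the empty set. -/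
structure IsPolymatroid {J : Type} (h : Set J → ℝ) : Prop where
  empty : h ∅ = 0
  mono : ∀ {A B}, A ⊆ B → h A ≤ h B
  submod : ∀ A B, h (A ∪ B) + h (A ∩ B) ≤ h A + h B

/-- Submodularity is `entropy_submodular` for the restrictions to `S`, `S'` and `S ∩ S'`; each tuple
of restrictions has the same fibres as the restriction to the union of their index sets. -/
theorem isPolymatroid_jointEntropy (q : ℕ) (P : Measure Ω) [IsProbabilityMeasure P]
    {A : J → Ω → B} (hA : ∀ j, IsDiscreteRV (A j)) : IsPolymatroid (jointEntropy q P A) := by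
  classical
  refine ⟨?_, ?_, ?_⟩
  · have : jointEntropy q P A ∅ = entropy q P fun _ => () :=
      (entropy_eq_jointEntropy _ (by simp)).symm
    rw [this]
    simp [entropy]
  · intro S S' hS
    have h1 := entropy_le_entropy_prod (q := q) (P := P) (isDiscreteRV_restrict hA S')
      (isDiscreteRV_restrict hA S)
    refine h1.trans (le_of_eq (entropy_eq_jointEntropy (A := A) S' fun ω ω' => ?_))
    rw [Prod.mk.injEq, restrict_eq_iff S' (fun j => A j ω) fun j => A j ω',
      restrict_eq_iff S (fun j => A j ω) fun j => A j ω']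
    exact ⟨fun h => h.1, fun h => ⟨h, fun j hj => h j (hS hj)⟩⟩
  · intro S S'
    have h1 := entropy_submodular (q := q) (P := P) (isDiscreteRV_restrict hA S)
      (isDiscreteRV_restrict hA S') (isDiscreteRV_restrict hA (S ∩ S'))
    have e1 := entropy_eq_jointEntropy (q := q) (P := P) (A := A) (S ∪ S')
      (X := fun ω => ((fun j => if j ∈ S then some (A j ω) else none : J → Option B),
        (fun j => if j ∈ S' then some (A j ω) else none : J → Option B),
        (fun j => if j ∈ S ∩ S' then some (A j ω) else none : J → Option B))) (fun ω ω' => by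
      rw [Prod.mk.injEq, Prod.mk.injEq, restrict_eq_iff S (fun j => A j ω) fun j => A j ω',
        restrict_eq_iff S' (fun j => A j ω) fun j => A j ω',
        restrict_eq_iff (S ∩ S') (fun j => A j ω) fun j => A j ω']
      simp only [Set.mem_inter_iff, Set.mem_union]
      grind)
    have e2 := entropy_eq_jointEntropy (q := q) (P := P) (A := A) S
      (X := fun ω => ((fun j => if j ∈ S then some (A j ω) else none : J → Option B),
        (fun j => if j ∈ S ∩ S' then some (A j ω) else none : J → Option B))) (fun ω ω' => by
      rw [Prod.mk.injEq, restrict_eq_iff S (fun j => A j ω) fun j => A j ω',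
        restrict_eq_iff (S ∩ S') (fun j => A j ω) fun j => A j ω']
      simp only [Set.mem_inter_iff]
      grind)
    have e3 := entropy_eq_jointEntropy (q := q) (P := P) (A := A) S'
      (X := fun ω => ((fun j => if j ∈ S' then some (A j ω) else none : J → Option B),
        (fun j => if j ∈ S ∩ S' then some (A j ω) else none : J → Option B))) (fun ω ω' => by
      rw [Prod.mk.injEq, restrict_eq_iff S' (fun j => A j ω) fun j => A j ω',
        restrict_eq_iff (S ∩ S') (fun j => A j ω) fun j => A j ω']
      simp only [Set.mem_inter_iff]
      grind)
    have e4 := entropy_eq_jointEntropy (q := q) (P := P) (A := A) (S ∩ S')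
      (X := fun ω => (fun j => if j ∈ S ∩ S' then some (A j ω) else none : J → Option B))
      (fun ω ω' => restrict_eq_iff (S ∩ S') (fun j => A j ω) fun j => A j ω')
    rw [e1, e2, e3, e4] at h1
    exact h1

end JointEntropy

/-! ### Closure and conditioning in a polymatroid -/

namespace IsPolymatroid

variable {J : Type} {h : Set J → ℝ}

/-- The closure of a set of variables: those it determines. -/
def cl (h : Set J → ℝ) (B : Set J) : Set J := {j | h (insert j B) = h B}

/-- By submodularity the increment from adding `j` shrinks as the set grows, so a zero increment
stays zero. -/
lemma mem_cl_of_subset (hh : IsPolymatroid h) {B B' : Set J} {j : J} (hj : j ∈ cl h B) (hB : B ⊆ B') :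
    j ∈ cl h B' := by
  refine le_antisymm ?_ (hh.mono (Set.subset_insert _ _))
  have h1 := hh.submod B' (insert j B)
  have h2 : h (insert j B) = h B := hj
  have h3 : h B ≤ h (B' ∩ insert j B) :=
    hh.mono (Set.subset_inter hB (Set.subset_insert _ _))
  have h4 : h (insert j B') ≤ h (B' ∪ insert j B) := hh.mono (by grind)
  linarith

lemma subset_cl (B : Set J) : B ⊆ cl h B := fun j hj => by
  simp [cl, Set.insert_eq_of_mem hj]

lemma union_eq_of_subset_cl [Finite J] (hh : IsPolymatroid h) {A B : Set J} (hA : A ⊆ cl h B) :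
    h (B ∪ A) = h B := by
  induction A, A.toFinite using Set.Finite.induction_on with
  | empty => simp
  | @insert a s _ _ ih =>
    rw [Set.union_insert, ← ih fun x hx => hA (Set.mem_insert_of_mem _ hx)]
    exact hh.mem_cl_of_subset (hA (Set.mem_insert _ _)) Set.subset_union_left

lemma le_of_subset_cl [Finite J] (hh : IsPolymatroid h) {A B : Set J} (hA : A ⊆ cl h B) :
    h A ≤ h B := by
  rw [← hh.union_eq_of_subset_cl hA]
  exact hh.mono Set.subset_union_right

lemma cl_subset_cl [Finite J] (hh : IsPolymatroid h) {A B : Set J} (hA : A ⊆ cl h B) :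
    cl h A ⊆ cl h B := by
  intro j hj
  refine le_antisymm ?_ (hh.mono (Set.subset_insert _ _))
  have h1 : h (insert j (B ∪ A)) = h (B ∪ A) := hh.mem_cl_of_subset hj Set.subset_union_right
  rw [hh.union_eq_of_subset_cl hA] at h1
  rw [← h1]
  exact hh.mono (Set.insert_subset_insert Set.subset_union_left)

lemma cl_mono [Finite J] (hh : IsPolymatroid h) {A B : Set J} (hA : A ⊆ B) :
    cl h A ⊆ cl h B :=
  hh.cl_subset_cl (hA.trans (subset_cl B))

/-- Conditioning on more variables reduces entropy. -/
lemma cond_anti [Finite J] (hh : IsPolymatroid h) (A : Set J) {B B' : Set J} (hB : B ⊆ cl h B') :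
    h (A ∪ B') - h B' ≤ h (A ∪ B) - h B := by
  have h1 := hh.submod (A ∪ B) (B' ∪ B)
  have h2 : h B ≤ h ((A ∪ B) ∩ (B' ∪ B)) :=
    hh.mono (Set.subset_inter Set.subset_union_right Set.subset_union_right)
  have h3 : h (A ∪ B') ≤ h ((A ∪ B) ∪ (B' ∪ B)) := hh.mono (by grind)
  rw [hh.union_eq_of_subset_cl hB] at h1
  linarith

lemma le_add (hh : IsPolymatroid h) (A B : Set J) : h (A ∪ B) ≤ h A + h B := by
  have h1 := hh.submod A B
  have h2 : h ∅ ≤ h (A ∩ B) := hh.mono (Set.empty_subset _)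
  rw [hh.empty] at h2
  linarith

end IsPolymatroid

/-! ### The variables and entropic constraints of a secure scheme -/

/-- The random variables of a network: inputs, keys, user messages, relay messages, the sum of the
inputs and the source key. -/
inductive Var (U V : ℕ) : Type
  | W (i : Fin U × Fin V)
  | Z (i : Fin U × Fin V)
  | X (i : Fin U × Fin V)
  | Y (u : Fin U)
  | S
  | ZS
  deriving DecidableEq, Fintype

namespace Var

variable {U V : ℕ}

/-- The inputs and keys of the users in `C`. -/
def known (C : Set (Fin U × Fin V)) : Set (Var U V) := W '' C ∪ Z '' C

/-- The user messages received by relay `u`. -/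
def relay (u : Fin U) : Set (Var U V) := Set.range fun v => X (u, v)

end Var

open Var IsPolymatroid

/-- The entropic content of a secure aggregation scheme with inputs of entropy `L`. -/
structure IsSecureRank {U V : ℕ} (h : Set (Var U V) → ℝ) (L : ℝ) (T : ℕ) : Prop where
  poly : IsPolymatroid h
  h_W : ∀ i, h {W i} ≤ L
  h_S : h {S} ≤ L
  indep : h (Set.range W ∪ Set.range Z) = h (Set.range Z) + U * V * L
  Z_mem : ∀ i, Z i ∈ cl h {ZS}
  X_mem : ∀ i, X i ∈ cl h {W i, Z i}
  Y_mem : ∀ u, Y u ∈ cl h (relay u)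
  S_mem : S ∈ cl h (Set.range Y)
  S_mem_W : S ∈ cl h (Set.range W)
  W_mem : ∀ i, W i ∈ cl h (insert S (W '' {i}ᶜ))
  relay_security : ∀ u, ∀ C : Finset (Fin U × Fin V), C.card ≤ T →
    h (relay u ∪ known C) - h (known C)
      = h (relay u ∪ (Set.range W ∪ known C)) - h (Set.range W ∪ known C)
  server_security : ∀ C : Finset (Fin U × Fin V), C.card ≤ T →
    h (Set.range Y ∪ ({S} ∪ known C)) - h ({S} ∪ known C)
      = h (Set.range Y ∪ (Set.range W ∪ ({S} ∪ known C))) - h (Set.range W ∪ ({S} ∪ known C))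

/-! ### Converse bounds -/

namespace IsSecureRank

variable {U V T : ℕ} {h : Set (Var U V) → ℝ} {L : ℝ}

lemma X_mem_cl (hs : IsSecureRank h L T)
    {B : Set (Var U V)} {i} (hW : W i ∈ cl h B) (hZ : Z i ∈ cl h B) : X i ∈ cl h B :=
  hs.poly.cl_subset_cl (by rintro _ (rfl | rfl) <;> assumption) (hs.X_mem i)

lemma Y_mem_cl (hs : IsSecureRank h L T)
    {B : Set (Var U V)} {u} (hX : ∀ v, X (u, v) ∈ cl h B) : Y u ∈ cl h B :=
  hs.poly.cl_subset_cl (by rintro _ ⟨v, rfl⟩; exact hX v) (hs.Y_mem u)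

lemma S_mem_cl (hs : IsSecureRank h L T)
    {B : Set (Var U V)} (hY : ∀ u, Y u ∈ cl h B) : S ∈ cl h B :=
  hs.poly.cl_subset_cl (by rintro _ ⟨v, rfl⟩; exact hY v) hs.S_mem

lemma W_mem_cl (hs : IsSecureRank h L T)
    {B : Set (Var U V)} {i} (hS : S ∈ cl h B) (hW : ∀ j ≠ i, W j ∈ cl h B) :
    W i ∈ cl h B :=
  hs.poly.cl_subset_cl (by rintro _ (rfl | ⟨j, hj, rfl⟩); exacts [hS, hW j hj]) (hs.W_mem i)

lemma W_mem_cl_known {C : Set (Fin U × Fin V)} {B : Set (Var U V)} (hB : known C ⊆ B) {i}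
    (hi : i ∈ C) : W i ∈ cl h B :=
  subset_cl _ (hB (Or.inl ⟨i, hi, rfl⟩))

lemma Z_mem_cl_known {C : Set (Fin U × Fin V)} {B : Set (Var U V)} (hB : known C ⊆ B) {i}
    (hi : i ∈ C) : Z i ∈ cl h B :=
  subset_cl _ (hB (Or.inr ⟨i, hi, rfl⟩))

lemma X_mem_cl_known (hs : IsSecureRank h L T)
    {C : Set (Fin U × Fin V)} {B : Set (Var U V)} (hB : known C ⊆ B) {i}
    (hi : i ∈ C) : X i ∈ cl h B :=
  hs.X_mem_cl (W_mem_cl_known hB hi) (Z_mem_cl_known hB hi)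

/-- Each input is independent of the other inputs and of all keys. -/
lemma input_indep (hs : IsSecureRank h L T) (i : Fin U × Fin V) :
    L + h (W '' {i}ᶜ ∪ Set.range Z) ≤ h (Set.range W ∪ Set.range Z) := by
  classical
  -- Subadditivity bounds the entropy of the other `UV - 1` inputs and all keys from above; the
  -- exact total in `indep` then leaves `L` for `W i`.
  have key : ∀ s : Finset (Fin U × Fin V),
      h (W '' (s : Set _) ∪ Set.range Z) ≤ h (Set.range Z) + s.card * L := by
    intro s
    induction s using Finset.induction_on with
    | empty => simp
    | insert a s ha ih =>
      have h1 := hs.poly.le_add {W a} (W '' (s : Set _) ∪ Set.range Z)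
      have h2 := hs.h_W a
      rw [Finset.coe_insert, Set.image_insert_eq, Finset.card_insert_of_notMem ha]
      rw [Set.singleton_union, ← Set.insert_union] at h1
      push_cast
      linarith
  have h1 := key {i}ᶜ
  rw [hs.indep]
  have h2 : ((({i}ᶜ : Finset (Fin U × Fin V)).card : ℕ) : ℝ) = U * V - 1 := by
    rw [Finset.card_compl, Nat.cast_sub (Finset.card_le_univ _)]
    simp
  rw [h2] at h1
  simp only [Finset.coe_compl, Finset.coe_singleton] at h1
  linarith

lemma input_indep_known (hs : IsSecureRank h L T)
    (i : Fin U × Fin V) : L + h (known {i}ᶜ) ≤ h ({W i} ∪ known {i}ᶜ) := by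
  have h1 := hs.poly.cond_anti {W i} (B := known {i}ᶜ) (B' := W '' {i}ᶜ ∪ Set.range Z)
    ((Set.union_subset_union_right _ (Set.image_subset_range _ _)).trans (subset_cl _))
  have h2 := hs.input_indep i
  have h3 : {W i} ∪ (W '' {i}ᶜ ∪ Set.range Z) = (Set.range W ∪ Set.range Z : Set (Var U V)) := by
    rw [← Set.union_assoc, ← Set.image_singleton, ← Set.image_union, Set.union_compl_self,
      Set.image_univ]
  rw [h3] at h1
  linarith

/-- A set of variables that, with the inputs and keys of all users but `i`, determines the sum has
conditional entropy at least `L`. -/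
lemma le_cond_of_S_mem (hs : IsSecureRank h L T) {A B : Set (Var U V)} (i : Fin U × Fin V)
    (hA : S ∈ cl h (A ∪ known {i}ᶜ)) (hB : B ⊆ cl h (known {i}ᶜ)) :
    L ≤ h (A ∪ B) - h B := by
  have h1 := hs.poly.cond_anti A hB
  have h2 := hs.input_indep_known i
  -- The sum and the other inputs determine `W i`, so `A` carries all the uncertainty of `W i`.
  have h3 : h ({W i} ∪ known {i}ᶜ) ≤ h (A ∪ known {i}ᶜ) := by
    refine hs.poly.le_of_subset_cl ?_
    refine Set.union_subset ?_ (Set.subset_union_right.trans (subset_cl _))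
    rw [Set.singleton_subset_iff]
    exact hs.W_mem_cl hA fun j hj => W_mem_cl_known Set.subset_union_right hj
  linarith

lemma S_mem_cl_user (hs : IsSecureRank h L T)
    (i : Fin U × Fin V) : S ∈ cl h ({X i} ∪ known {i}ᶜ) := by
  refine hs.S_mem_cl fun u => hs.Y_mem_cl fun v => ?_
  by_cases hi : (u, v) = i
  · exact subset_cl _ (Or.inl (by simp [hi]))
  · exact hs.X_mem_cl_known Set.subset_union_right hi

lemma S_mem_cl_relay (hs : IsSecureRank h L T)
    (u : Fin U) (v : Fin V) : S ∈ cl h ({Y u} ∪ known {(u, v)}ᶜ) := by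
  refine hs.S_mem_cl fun u' => ?_
  by_cases hu : u' = u
  · exact subset_cl _ (Or.inl (by simp [hu]))
  · exact hs.Y_mem_cl fun v' => hs.X_mem_cl_known Set.subset_union_right (by simp [hu])

lemma le_user_message (hs : IsSecureRank h L T)
    {B : Set (Var U V)} (i : Fin U × Fin V) (hB : B ⊆ cl h (known {i}ᶜ)) :
    L ≤ h ({X i} ∪ B) - h B :=
  hs.le_cond_of_S_mem i (hs.S_mem_cl_user i) hB

lemma le_relay_message (hs : IsSecureRank h L T) {B : Set (Var U V)} (u : Fin U) (v : Fin V)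
    (hB : B ⊆ cl h (known {(u, v)}ᶜ)) : L ≤ h ({Y u} ∪ B) - h B :=
  hs.le_cond_of_S_mem (u, v) (hs.S_mem_cl_relay u v) hB

lemma le_h_X (hs : IsSecureRank h L T) (i : Fin U × Fin V) : L ≤ h {X i} := by
  simpa [hs.poly.empty] using hs.le_user_message (B := ∅) i (Set.empty_subset _)

lemma le_h_Y (hs : IsSecureRank h L T) (hV : 1 ≤ V) (u : Fin U) : L ≤ h {Y u} := by
  simpa [hs.poly.empty] using hs.le_relay_message (B := ∅) u ⟨0, hV⟩ (Set.empty_subset _)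

/-- Messages that are functions of the inputs and of the keys `Q` are at most as uncertain, given
all inputs and the keys `C`, as the keys `Q`. -/
lemma message_le_key (hs : IsSecureRank h L T) {M : Set (Var U V)} {Q C : Set (Fin U × Fin V)}
    (hM : M ⊆ cl h (Set.range W ∪ Z '' Q)) :
    h (M ∪ (Set.range W ∪ known C)) - h (Set.range W ∪ known C)
      ≤ h (Z '' Q ∪ Z '' C) - h (Z '' C) := by
  have h1 := hs.poly.cond_anti (Z '' Q) (B := Z '' C) (B' := Set.range W ∪ known C)
    (fun x hx => subset_cl _ (Or.inr (Or.inr hx)))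
  have h2 : h (M ∪ (Set.range W ∪ known C)) ≤ h (Z '' Q ∪ (Set.range W ∪ known C)) := by
    refine hs.poly.le_of_subset_cl (Set.union_subset ?_ (Set.subset_union_right.trans (subset_cl _)))
    exact hM.trans (hs.poly.cl_mono (by grind))
  linarith

lemma user_subset_cl (hs : IsSecureRank h L T)
    {Q : Set (Fin U × Fin V)} : X '' Q ⊆ cl h (Set.range W ∪ Z '' Q) := by
  rintro _ ⟨i, hi, rfl⟩
  exact hs.X_mem_cl (subset_cl _ (Or.inl ⟨i, rfl⟩)) (subset_cl _ (Or.inr ⟨i, hi, rfl⟩))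

/-- Relay security holds for every part of the messages that the relay receives. -/
lemma relay_security_subset (hs : IsSecureRank h L T)
    {M : Set (Var U V)} {u : Fin U} (hM : M ⊆ relay u)
    {C : Finset (Fin U × Fin V)} (hC : C.card ≤ T) :
    h (M ∪ known C) - h (known C) ≤ h (M ∪ (Set.range W ∪ known C)) - h (Set.range W ∪ known C) := by
  have h1 := hs.relay_security u C hC
  -- Chain rule: the messages beyond `M` do not gain entropy from conditioning on `W`, so
  -- subtracting them from the security identity leaves the inequality for `M`.
  have h2 := hs.poly.cond_anti (relay u) (B := M ∪ known C) (B' := M ∪ (Set.range W ∪ known C))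
    ((Set.union_subset_union_right _ Set.subset_union_right).trans (subset_cl _))
  rw [← Set.union_assoc, ← Set.union_assoc (relay u) M, Set.union_eq_left.2 hM] at h2
  linarith

/-- Given what `C` knows, `X i` has entropy at least `L`, because it carries `W i`. Relay security
keeps this entropy given all inputs, where the only randomness left in `X i` is that of `Z i`. -/
lemma key_step (hs : IsSecureRank h L T)
    {i : Fin U × Fin V} {C : Finset (Fin U × Fin V)} (hi : i ∉ C) (hC : C.card ≤ T) :
    L ≤ h ({Z i} ∪ Z '' (C : Set _)) - h (Z '' (C : Set _)) := by
  have h1 := hs.message_le_key (M := {X i}) (Q := {i}) (C := C)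
    (by simpa using hs.user_subset_cl (Q := {i}))
  have h2 := hs.relay_security_subset (M := {X i}) (u := i.1)
    (by rintro _ rfl; exact ⟨i.2, rfl⟩) hC
  have h3 := hs.le_user_message (B := known C) i
    (subset_cl _ |>.trans' (Set.union_subset_union (Set.image_mono (by grind))
      (Set.image_mono (by grind))))
  rw [Set.image_singleton] at h1
  linarith

lemma le_h_Z (hs : IsSecureRank h L T) (i : Fin U × Fin V) : L ≤ h {Z i} := by
  simpa [hs.poly.empty] using hs.key_step (i := i) (C := ∅) (by simp) (by simp)

lemma card_mul_le_keys (hs : IsSecureRank h L T) (C : Finset (Fin U × Fin V)) (hC : C.card ≤ T) :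
    C.card * L ≤ h (Z '' (C : Set _)) := by
  classical
  induction C using Finset.induction_on with
  | empty => simp [hs.poly.empty]
  | insert a s ha ih =>
    rw [Finset.card_insert_of_notMem ha] at hC
    have h1 := ih (by omega)
    have h2 := hs.key_step ha (by omega)
    rw [Finset.coe_insert, Set.image_insert_eq, Finset.card_insert_of_notMem ha]
    rw [Set.singleton_union] at h2
    push_cast
    linarith

lemma keys_le_source (hs : IsSecureRank h L T) (Q : Set (Fin U × Fin V)) : h (Z '' Q) ≤ h {ZS} := by
  refine hs.poly.le_of_subset_cl ?_
  rintro _ ⟨i, _, rfl⟩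
  exact hs.Z_mem i

/-- Chain rule over the users of relay `u`: the earlier messages and the knowledge of `C` are
functions of data of users other than the current one, so `le_user_message` yields a fresh `L` each
time. -/
lemma card_mul_le_relay (hs : IsSecureRank h L T)
    {u : Fin U} {C : Finset (Fin U × Fin V)} (hC : ∀ v, (u, v) ∉ C) :
    V * L ≤ h (relay u ∪ known C) - h (known C) := by
  classical
  have key : ∀ s : Finset (Fin V),
      s.card * L ≤ h ((fun v => X (u, v)) '' (s : Set (Fin V)) ∪ known C) - h (known C) := by
    intro s
    induction s using Finset.induction_on with
    | empty => simp
    | insert a s ha ih =>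
      have h1 := hs.le_user_message (B := (fun v => X (u, v)) '' (s : Set (Fin V)) ∪ known C) (u, a)
        (by
          rintro _ (⟨v, hv, rfl⟩ | ⟨j, hj, rfl⟩ | ⟨j, hj, rfl⟩)
          · refine hs.X_mem_cl_known subset_rfl ?_
            rintro ⟨⟩
            exact ha hv
          · refine W_mem_cl_known subset_rfl ?_
            rintro rfl
            exact hC a hj
          · refine Z_mem_cl_known subset_rfl ?_
            rintro rfl
            exact hC a hj)
      rw [Finset.coe_insert, Set.image_insert_eq, Finset.card_insert_of_notMem ha]
      rw [← Set.union_assoc, Set.singleton_union] at h1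
      push_cast
      linarith
  simpa [relay] using key Finset.univ

/-- The source key bound from relay security. -/
theorem relay_source_bound (hs : IsSecureRank h L T)
    (u : Fin U) {C : Finset (Fin U × Fin V)} (hC : ∀ v, (u, v) ∉ C)
    (hcard : C.card = T) : (V + T) * L ≤ h {ZS} := by
  have hrel : relay u = X '' {i : Fin U × Fin V | i.1 = u} := by
    ext x
    constructor
    · rintro ⟨v, rfl⟩; exact ⟨(u, v), rfl, rfl⟩
    · rintro ⟨⟨_, v⟩, rfl, rfl⟩; exact ⟨v, rfl⟩
  have h1 := hs.message_le_key (C := C) (hs.user_subset_cl (Q := {i : Fin U × Fin V | i.1 = u}))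
  rw [← hrel] at h1
  have h2 := hs.relay_security u C hcard.le
  have h3 := hs.card_mul_le_relay hC
  have h4 := hs.card_mul_le_keys C hcard.le
  rw [← Set.image_union] at h1
  have h5 := hs.keys_le_source ({i : Fin U × Fin V | i.1 = u} ∪ C)
  rw [hcard] at h4
  linarith

/-- Chain rule over the relays: the user of each relay left out by `C` makes that relay's message
uncertain by `L`, even given the earlier relay messages. -/
lemma card_mul_le_server (hs : IsSecureRank h L T)
    {C : Finset (Fin U × Fin V)} (hC : ∀ u, ∃ v, (u, v) ∉ C) :
    U * L ≤ h (Set.range Y ∪ known C) - h (known C) := by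
  classical
  have key : ∀ s : Finset (Fin U), s.card * L ≤ h (Y '' (s : Set _) ∪ known C) - h (known C) := by
    intro s
    induction s using Finset.induction_on with
    | empty => simp
    | insert a s ha ih =>
      obtain ⟨v, hv⟩ := hC a
      have h1 := hs.le_relay_message (B := Y '' (s : Set _) ∪ known C) a v
        (by
          rintro _ (⟨u, hu, rfl⟩ | ⟨j, hj, rfl⟩ | ⟨j, hj, rfl⟩)
          · refine hs.Y_mem_cl fun v' => hs.X_mem_cl_known subset_rfl ?_
            rintro ⟨⟩
            exact ha hu
          · refine W_mem_cl_known subset_rfl ?_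
            rintro rfl
            exact hv hj
          · refine Z_mem_cl_known subset_rfl ?_
            rintro rfl
            exact hv hj)
      rw [Finset.coe_insert, Set.image_insert_eq, Finset.card_insert_of_notMem ha]
      rw [← Set.union_assoc, Set.singleton_union] at h1
      push_cast
      linarith
  simpa using key Finset.univ

/-- The source key bound from server security. -/
theorem server_source_bound (hs : IsSecureRank h L T)
    {C : Finset (Fin U × Fin V)} (hC : ∀ u, ∃ v, (u, v) ∉ C)
    (hcard : C.card ≤ T) : (U + C.card - 1) * L ≤ h {ZS} := by
  have h1 := hs.message_le_key (M := Set.range Y) (Q := Set.univ) (C := C) (by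
    rintro _ ⟨u, rfl⟩
    exact hs.Y_mem_cl fun v => hs.user_subset_cl ⟨(u, v), Set.mem_univ _, rfl⟩)
  have h2 := hs.server_security C hcard
  have h3 := hs.card_mul_le_server hC
  have h4 := hs.card_mul_le_keys C hcard
  have h5 := hs.keys_le_source Set.univ
  -- Given all inputs the sum is redundant, so it drops out of the right side of server security.
  have hSW : Set.range W ∪ ({S} ∪ known C) = Set.range W ∪ known C ∪ ({S} : Set (Var U V)) := by
    grind
  have hSW' : Set.range Y ∪ (Set.range W ∪ ({S} ∪ known C))
      = Set.range Y ∪ (Set.range W ∪ known C) ∪ ({S} : Set (Var U V)) := by grind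
  have hS : S ∈ cl h (Set.range W ∪ known C) :=
    hs.poly.cl_mono Set.subset_union_left hs.S_mem_W
  have hS' : S ∈ cl h (Set.range Y ∪ (Set.range W ∪ known C)) :=
    hs.poly.cl_mono Set.subset_union_right hS
  rw [hSW', hSW, hs.poly.union_eq_of_subset_cl (Set.singleton_subset_iff.2 hS),
    hs.poly.union_eq_of_subset_cl (Set.singleton_subset_iff.2 hS')] at h2
  -- On the left side, conditioning on the sum costs at most `L`: this is the `- 1` in the bound.
  have h6 := hs.poly.le_add {S} (known C)
  have h7 := hs.h_S
  have h8 : h (Set.range Y ∪ known C) ≤ h (Set.range Y ∪ ({S} ∪ known C)) :=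
    hs.poly.mono (by grind)
  rw [← Set.image_union, Set.univ_union] at h1
  linarith

/-- A relay that colludes with all users of the other relays learns the sum. -/
theorem not_all_others_collude (hs : IsSecureRank h L T)
    (hL : 0 < L) (u : Fin U) (v : Fin V) {C : Finset (Fin U × Fin V)}
    (hC : ∀ i, i ∈ C ↔ i.1 ≠ u) : ¬ C.card ≤ T := by
  intro hcard
  have h1 := hs.relay_security u C hcard
  have hS : S ∈ cl h (relay u ∪ known C) := by
    refine hs.S_mem_cl fun u' => hs.Y_mem_cl fun v' => ?_
    by_cases hu : u' = u
    · exact subset_cl _ (Or.inl ⟨v', by rw [hu]⟩)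
    · exact hs.X_mem_cl_known Set.subset_union_right ((hC _).2 hu)
  -- With `h1`, and since relay and colluders determine the sum, this forces the sum to have no
  -- entropy given `known C`. In `h6` it has at least `L`, as user `(u, v)` is outside `C`.
  have h2 := hs.poly.cond_anti (relay u) (B := {S} ∪ known C) (B' := {S} ∪ (Set.range W ∪ known C))
    ((Set.union_subset_union_right _ Set.subset_union_right).trans (subset_cl _))
  have h3 : h (relay u ∪ ({S} ∪ known C)) = h (relay u ∪ known C) := by
    rw [← hs.poly.union_eq_of_subset_cl (Set.singleton_subset_iff.2 hS)]
    congr 1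
    grind
  have hSW : S ∈ cl h (Set.range W ∪ known C) :=
    hs.poly.cl_mono Set.subset_union_left hs.S_mem_W
  have h4 : h ({S} ∪ (Set.range W ∪ known C)) = h (Set.range W ∪ known C) := by
    rw [Set.union_comm, hs.poly.union_eq_of_subset_cl (Set.singleton_subset_iff.2 hSW)]
  have h5 : h (relay u ∪ (Set.range W ∪ known C)) ≤ h (relay u ∪ ({S} ∪ (Set.range W ∪ known C))) :=
    hs.poly.mono (by grind)
  have h6 := hs.le_cond_of_S_mem (A := {S}) (B := known C) (u, v)
    (subset_cl _ (Or.inl rfl)) (by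
      refine (Set.union_subset_union (Set.image_mono ?_) (Set.image_mono ?_)).trans (subset_cl _) <;>
      · rintro i hi rfl
        exact (hC _).1 hi rfl)
  linarith

end IsSecureRank

/-! ### From networks to entropic constraints -/

namespace Network

open Var IsPolymatroid

variable {F : Type} [Field F] [Fintype F] {U V L : ℕ} (N : Network F U V L)

/-- The random variables of a network as a family with a common alphabet. -/
def family : Var U V → N.Ω → (Fin L → F) ⊕ N.AZ ⊕ N.AX ⊕ N.AY ⊕ N.AZS
  | .W i, ω => .inl (N.W i ω)
  | .Z i, ω => .inr (.inl (N.Z i ω))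
  | .X i, ω => .inr (.inr (.inl (N.X i ω)))
  | .Y u, ω => .inr (.inr (.inr (.inl (N.Y u ω))))
  | .S, ω => .inl (N.sumW ω)
  | .ZS, ω => .inr (.inr (.inr (.inr (N.ZS ω))))

@[simp] lemma family_W (i : Fin U × Fin V) (ω ω' : N.Ω) :
    N.family (Var.W i) ω = N.family (Var.W i) ω' ↔ N.W i ω = N.W i ω' := by
  simp [family]

@[simp] lemma family_Z (i : Fin U × Fin V) (ω ω' : N.Ω) :
    N.family (Var.Z i) ω = N.family (Var.Z i) ω' ↔ N.Z i ω = N.Z i ω' := by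
  simp [family]

@[simp] lemma family_X (i : Fin U × Fin V) (ω ω' : N.Ω) :
    N.family (Var.X i) ω = N.family (Var.X i) ω' ↔ N.X i ω = N.X i ω' := by
  simp [family]

@[simp] lemma family_Y (u : Fin U) (ω ω' : N.Ω) :
    N.family (Var.Y u) ω = N.family (Var.Y u) ω' ↔ N.Y u ω = N.Y u ω' := by
  simp [family]

@[simp] lemma family_S (ω ω' : N.Ω) :
    N.family (Var.S) ω = N.family (Var.S) ω' ↔ N.sumW ω = N.sumW ω' := by
  simp [family]

@[simp] lemma family_ZS (ω ω' : N.Ω) :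
    N.family (Var.ZS) ω = N.family (Var.ZS) ω' ↔ N.ZS ω = N.ZS ω' := by
  simp [family]

open Classical in
/-- Joint entropy of a set of variables of the network. -/
def rank (A : Set (Var U V)) : ℝ := jointEntropy (Fintype.card F) N.P N.family A

lemma isDiscreteRV_sumW : IsDiscreteRV N.sumW := by
  classical
  exact (IsDiscreteRV.pi N.meas_W).comp (fun w : Fin U × Fin V → (Fin L → F) => ∑ i, w i)

lemma isDiscreteRV_family (j : Var U V) : IsDiscreteRV (N.family j) := by
  classical
  cases j with
  | W i => exact (N.meas_W i).comp Sum.inl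
  | Z i => exact (N.meas_Z i).comp (Sum.inr ∘ Sum.inl)
  | X i => exact (N.meas_X i).comp (Sum.inr ∘ Sum.inr ∘ Sum.inl)
  | Y u => exact (N.meas_Y u).comp (Sum.inr ∘ Sum.inr ∘ Sum.inr ∘ Sum.inl)
  | S => exact N.isDiscreteRV_sumW.comp Sum.inl
  | ZS => exact N.meas_ZS.comp (Sum.inr ∘ Sum.inr ∘ Sum.inr ∘ Sum.inr)

lemma isPolymatroid_rank : IsPolymatroid N.rank :=
  isPolymatroid_jointEntropy _ _ N.isDiscreteRV_family

/-- The random variable `f` and the variables in `A` are functions of each other. -/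
def Generates {α : Type} (f : N.Ω → α) (A : Set (Var U V)) : Prop :=
  ∀ ω ω', f ω = f ω' ↔ ∀ j ∈ A, N.family j ω = N.family j ω'

variable {N} in
lemma Generates.H_eq {α : Type} [Fintype α] {f : N.Ω → α} {A : Set (Var U V)}
    (hf : N.Generates f A) : N.H f = N.rank A :=
  entropy_eq_jointEntropy A hf

variable {N} in
lemma Generates.prod {α β : Type} {f : N.Ω → α} {g : N.Ω → β} {A B : Set (Var U V)}
    (hf : N.Generates f A) (hg : N.Generates g B) :
    N.Generates (fun ω => (f ω, g ω)) (A ∪ B) := by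
  intro ω ω'
  rw [Prod.mk.injEq, hf, hg]
  simp only [Set.mem_union, or_imp, forall_and]

variable {N} in
lemma Generates.mem_cl {α β : Type} [Fintype α] [Fintype β] {f : N.Ω → α} {g : N.Ω → β}
    {j : Var U V} {A B : Set (Var U V)} (hf : N.Generates f A) (hg : N.Generates g B) (hj : j ∈ A)
    (h0 : N.condH f g = 0) : j ∈ cl N.rank B := by
  have h1 : N.H (fun ω => (f ω, g ω)) = N.H g := sub_eq_zero.1 h0
  rw [(hf.prod hg).H_eq, hg.H_eq] at h1
  exact le_antisymm (h1 ▸ N.isPolymatroid_rank.mono (by grind))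
    (N.isPolymatroid_rank.mono (Set.subset_insert _ _))

variable {N} in
lemma Generates.condI_eq {α β γ : Type} [Fintype α] [Fintype β] [Fintype γ] {f : N.Ω → α}
    {g : N.Ω → β} {k : N.Ω → γ} {A B C : Set (Var U V)} (hf : N.Generates f A)
    (hg : N.Generates g B) (hk : N.Generates k C) (h0 : N.condI f g k = 0) :
    N.rank (A ∪ C) - N.rank C = N.rank (A ∪ (B ∪ C)) - N.rank (B ∪ C) := by
  rw [← (hf.prod hk).H_eq, ← hk.H_eq, ← (hf.prod (hg.prod hk)).H_eq, ← (hg.prod hk).H_eq]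
  exact sub_eq_zero.1 h0

lemma generates_W (i) : N.Generates (N.W i) {Var.W i} := fun ω ω' => by simp
lemma generates_Z (i) : N.Generates (N.Z i) {Var.Z i} := fun ω ω' => by simp
lemma generates_X (i) : N.Generates (N.X i) {Var.X i} := fun ω ω' => by simp
lemma generates_Y (u) : N.Generates (N.Y u) {Var.Y u} := fun ω ω' => by simp
lemma generates_sumW : N.Generates N.sumW {Var.S} := fun ω ω' => by simp
lemma generates_ZS : N.Generates N.ZS {Var.ZS} := fun ω ω' => by simp

lemma generates_allW : N.Generates N.allW (Set.range Var.W) := fun ω ω' => by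
  rw [Set.forall_mem_range, funext_iff]
  simp [allW]

lemma generates_allZ : N.Generates N.allZ (Set.range Var.Z) := fun ω ω' => by
  rw [Set.forall_mem_range, funext_iff]
  simp [allZ]

lemma generates_allY : N.Generates N.allY (Set.range Var.Y) := fun ω ω' => by
  rw [Set.forall_mem_range, funext_iff]
  simp [allY]

lemma generates_relayX (u) : N.Generates (N.relayX u) (relay u) := fun ω ω' => by
  rw [relay, Set.forall_mem_range, funext_iff]
  simp [relayX]

lemma generates_collusion (C : Finset (Fin U × Fin V)) :
    N.Generates (N.collusion C) (known C) := fun ω ω' => by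
  rw [funext_iff]
  simp only [known, Set.mem_union, or_imp, forall_and, Set.forall_mem_image, family_W, family_Z,
    collusion, Prod.mk.injEq, Subtype.forall, Finset.mem_coe]

lemma mem_cl_of_eq {j : Var U V} {A : Set (Var U V)}
    (hj : ∀ ω ω', (∀ a ∈ A, N.family a ω = N.family a ω') → N.family j ω = N.family j ω') :
    j ∈ cl N.rank A := by
  classical
  have h1 : N.Generates (fun ω (a : A) => N.family a ω) A := fun ω ω' => by simp [funext_iff]
  have h2 : N.Generates (fun ω (a : A) => N.family a ω) (insert j A) := fun ω ω' => by
    rw [h1, Set.forall_mem_insert]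
    exact ⟨fun h => ⟨hj _ _ h, h⟩, fun h => h.2⟩
  exact h2.H_eq.symm.trans h1.H_eq

lemma one_lt_card : (1 : ℝ) < Fintype.card F := by exact_mod_cast Fintype.one_lt_card

lemma H_W {T : ℕ} (hN : N.IsSecureScheme T) (i : Fin U × Fin V) : N.H (N.W i) = L := by
  have hq := one_lt_card (F := F)
  have hlog := Real.log_pos hq
  have hq0 : (Fintype.card F : ℝ) ^ L ≠ 0 := by positivity
  simp only [H, entropy, hN.uniform i, Finset.sum_const, Finset.card_univ, Fintype.card_fun,
    Fintype.card_fin, nsmul_eq_mul, Real.negMulLog, one_div, Real.log_inv, Real.log_pow,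
    Nat.cast_pow]
  field_simp

lemma H_sumW_le : N.H N.sumW ≤ L := by
  have hlog := Real.log_pos (one_lt_card (F := F))
  refine (entropy_le_log_card N.isDiscreteRV_sumW).trans (le_of_eq ?_)
  simp only [Fintype.card_fun, Fintype.card_fin, Nat.cast_pow, Real.log_pow]
  field_simp

theorem isSecureRank {T : ℕ} (hN : N.IsSecureScheme T) : IsSecureRank N.rank L T where
  poly := N.isPolymatroid_rank
  h_W i := by rw [← (N.generates_W i).H_eq, N.H_W hN]
  h_S := by
    rw [← N.generates_sumW.H_eq]
    exact N.H_sumW_le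
  indep := by
    have h1 := hN.indep
    simp only [N.H_W hN] at h1
    rw [(N.generates_allZ.prod N.generates_allW).H_eq, N.generates_allZ.H_eq] at h1
    rw [Set.union_comm, h1]
    simp
  Z_mem i := N.generates_allZ.mem_cl N.generates_ZS ⟨i, rfl⟩ hN.key_generation
  X_mem i := (N.generates_X i).mem_cl ((N.generates_W i).prod (N.generates_Z i)) rfl
    (hN.user_message i)
  Y_mem u := (N.generates_Y u).mem_cl (N.generates_relayX u) rfl (hN.relay_message u)
  S_mem := N.generates_sumW.mem_cl N.generates_allY rfl hN.correctness
  S_mem_W := N.mem_cl_of_eq fun ω ω' hω => by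
    simp only [Set.forall_mem_range, family_W] at hω
    simp [sumW, hω]
  W_mem i := N.mem_cl_of_eq fun ω ω' hω => by
    classical
    simp only [Set.forall_mem_insert, Set.forall_mem_image, family_S, family_W,
      Set.mem_compl_iff, Set.mem_singleton_iff, sumW] at hω
    obtain ⟨hS, hW⟩ := hω
    rw [← Finset.add_sum_erase _ _ (Finset.mem_univ i),
      ← Finset.add_sum_erase _ (fun j => N.W j ω') (Finset.mem_univ i),
      Finset.sum_congr rfl fun j hj => hW (Finset.ne_of_mem_erase hj)] at hS
    exact (N.family_W i ω ω').2 (add_right_cancel hS)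
  relay_security u C hC := (N.generates_relayX u).condI_eq N.generates_allW
    (N.generates_collusion C) (hN.relay_security u C hC)
  server_security C hC := N.generates_allY.condI_eq N.generates_allW
    (N.generates_sumW.prod (N.generates_collusion C)) (hN.server_security C hC)

end Network

/-! ### Necessary conditions on achievable rates -/

/-- In a secure scheme not all users of `U - 1` relays may collude. -/
theorem Achievable.lt {F : Type} [Field F] [Fintype F] {U V T : ℕ} {R : ℝ × ℝ × ℝ × ℝ}
    (hU : 2 ≤ U) (hV : 1 ≤ V) (hR : Achievable F U V T R) : T < (U - 1) * V := by
  classical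
  obtain ⟨L, hL, N, hN, -⟩ := hR
  have hs := N.isSecureRank hN
  by_contra hT
  refine hs.not_all_others_collude (by exact_mod_cast hL) ⟨0, by omega⟩ ⟨0, hV⟩
    (C := ({⟨0, by omega⟩}ᶜ : Finset (Fin U)) ×ˢ Finset.univ) (by simp) ?_
  rw [Finset.card_product, Finset.card_compl]
  simpa using hT

/-- Any number `n ≤ U * (V - 1)` of users can be chosen that leave out a user of each relay. -/
lemma exists_finset_card_eq_of_le {U V n : ℕ} (hV : 1 ≤ V) (hn : n ≤ U * (V - 1)) :
    ∃ C : Finset (Fin U × Fin V), C.card = n ∧ ∀ u, ∃ v, (u, v) ∉ C := by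
  classical
  have hc : ((Finset.univ : Finset (Fin U)) ×ˢ ({⟨0, hV⟩}ᶜ : Finset (Fin V))).card
      = U * (V - 1) := by
    rw [Finset.card_product, Finset.card_compl]
    simp
  obtain ⟨C, hC, hcard⟩ := Finset.exists_subset_card_eq (hc ▸ hn)
  exact ⟨C, hcard, fun u => ⟨⟨0, hV⟩, fun h => by simpa using hC h⟩⟩

theorem Achievable.bounds {F : Type} [Field F] [Fintype F] {U V T : ℕ} {R : ℝ × ℝ × ℝ × ℝ}
    (hU : 2 ≤ U) (hV : 1 ≤ V) (hR : Achievable F U V T R) :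
    1 ≤ R.1 ∧ 1 ≤ R.2.1 ∧ 1 ≤ R.2.2.1 ∧
      max ((V : ℝ) + T) (min ((U : ℝ) * V - 1) ((U : ℝ) + T - 1)) ≤ R.2.2.2 := by
  classical
  have hT := hR.lt hU hV
  obtain ⟨L, hL, N, hN, hX, hY, hZ, hZS⟩ := hR
  have hs := N.isSecureRank hN
  have hL0 : (0 : ℝ) < L := by exact_mod_cast hL
  let u₀ : Fin U := ⟨0, by omega⟩
  let v₀ : Fin V := ⟨0, hV⟩
  have eX := (N.generates_X (u₀, v₀)).H_eq
  have eY := (N.generates_Y u₀).H_eq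
  have eZ := (N.generates_Z (u₀, v₀)).H_eq
  have eZS := N.generates_ZS.H_eq
  refine ⟨((one_le_div hL0).2 ?_).trans (hX (u₀, v₀)), ((one_le_div hL0).2 ?_).trans (hY u₀),
    ((one_le_div hL0).2 ?_).trans (hZ (u₀, v₀)), le_trans ?_ hZS⟩
  · exact eX ▸ hs.le_h_X _
  · exact eY ▸ hs.le_h_Y hV _
  · exact eZ ▸ hs.le_h_Z _
  · rw [le_div_iff₀ hL0, eZS, max_mul_of_nonneg _ _ hL0.le]
    refine max_le ?_ ?_
    · have hc : (({u₀}ᶜ : Finset (Fin U)) ×ˢ (Finset.univ : Finset (Fin V))).card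
          = (U - 1) * V := by
        rw [Finset.card_product, Finset.card_compl]
        simp
      obtain ⟨C, hC, hcard⟩ := Finset.exists_subset_card_eq (hc ▸ hT.le)
      exact hs.relay_source_bound u₀ (fun v h => by simpa using hC h) hcard
    -- At most `U * (V - 1)` colluders can spare a user in every relay. With `|C| = min T (U * (V -
    -- 1))` the bound `U + |C| - 1` becomes the minimum of `U + T - 1` and `UV - 1`.
    · obtain ⟨C, hcard, hC⟩ := exists_finset_card_eq_of_le (U := U) hV (min_le_right T (U * (V - 1)))
      have h1 := hs.server_source_bound hC (hcard ▸ min_le_left _ _)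
      refine le_trans (mul_le_mul_of_nonneg_right ?_ hL0.le) h1
      rw [hcard]
      obtain ⟨V, rfl⟩ : ∃ k, V = k + 1 := ⟨V - 1, by omega⟩
      push_cast
      rcases le_total (T : ℝ) (U * V) with h | h
      · rw [min_eq_left h]
        exact min_le_right _ _
      · rw [min_eq_right h]
        refine (min_le_left _ _).trans (le_of_eq ?_)
        ring

/-! ### Entropy of linear functions of a uniform vector -/

section LinearEntropy

open ProbabilityTheory Module

variable {F : Type} [Field F] [Fintype F]
variable {E : Type} [AddCommGroup E] [Module F E] [Fintype E]
  [MeasurableSpace E] [DiscreteMeasurableSpace E]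
variable {M M' M'' : Type} [AddCommGroup M] [Module F M] [Fintype M]
  [AddCommGroup M'] [Module F M'] [Fintype M'] [AddCommGroup M''] [Module F M''] [Fintype M'']

/-- The uniform probability measure on a finite type. -/
def uniform (E : Type) [MeasurableSpace E] : Measure E := ProbabilityTheory.uniformOn Set.univ

instance isProbabilityMeasure_uniform (E : Type) [MeasurableSpace E] [DiscreteMeasurableSpace E]
    [Fintype E] [Nonempty E] : IsProbabilityMeasure (uniform E) :=
  isProbabilityMeasure_uniformOn Set.finite_univ Set.univ_nonempty

/-- Nonempty fibres are cosets of the kernel, hence equally likely, and there are `q ^ rank` of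
them. -/
lemma uniform_real_linearMap (f : E →ₗ[F] M) {x : M} (hx : x ∈ LinearMap.range f) :
    (uniform E).real (f ⁻¹' {x}) = 1 / (Fintype.card F : ℝ) ^ finrank F (LinearMap.range f) := by
  classical
  have hfin : ∀ y : M, (f ⁻¹' {y} : Set E) = ((Finset.univ.filter fun ω => f ω = y : Finset E) :
      Set E) := fun y => by ext; simp
  have hreal : ∀ y : M, (uniform E).real (f ⁻¹' {y})
      = (Finset.univ.filter fun ω => f ω = y).card / Fintype.card E := by
    intro y
    rw [measureReal_def, uniform, uniformOn_univ, hfin, Measure.count_apply_finset]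
    simp
  have hconst : ∀ y ∈ LinearMap.range f,
      (uniform E).real (f ⁻¹' {y}) = (uniform E).real (f ⁻¹' {x}) := by
    intro y hy
    rw [hreal, hreal, AddMonoidHom.card_fiber_eq_of_mem_range f hy hx]
  have hzero : ∀ y ∉ LinearMap.range f, (uniform E).real (f ⁻¹' {y}) = 0 := by
    intro y hy
    have : (f ⁻¹' {y} : Set E) = ∅ := by
      ext ω
      simp only [Set.mem_preimage, Set.mem_singleton_iff, Set.mem_empty_iff_false, iff_false]
      exact fun h => hy ⟨ω, h⟩
    simp [this]
  have hsum := sum_real_preimage (P := uniform E) (X := f)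
    fun s _ => MeasurableSet.of_discrete
  have hsum' : ∑ y : LinearMap.range f, (uniform E).real (f ⁻¹' {(y : M)}) = 1 := by
    rw [← hsum]
    refine Fintype.sum_of_injective Subtype.val Subtype.val_injective _ _ ?_ fun _ => rfl
    intro y hy
    exact hzero y (by simpa using hy)
  rw [Finset.sum_congr rfl fun (y : LinearMap.range f) _ => hconst y y.2, Finset.sum_const,
    nsmul_eq_mul, Finset.card_univ, card_eq_pow_finrank (K := F)] at hsum'
  push_cast at hsum'
  exact eq_one_div_of_mul_eq_one_right hsum'

/-- The entropy of a linear function of a uniform vector is its rank. -/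
lemma entropy_linearMap (f : E →ₗ[F] M) :
    entropy (Fintype.card F) (uniform E) f = finrank F (LinearMap.range f) := by
  classical
  have hq : (1 : ℝ) < Fintype.card F := by exact_mod_cast Fintype.one_lt_card
  have hlog := Real.log_pos hq
  have hsum : ∑ x : M, Real.negMulLog ((uniform E).real (f ⁻¹' {x}))
      = ∑ y : LinearMap.range f, Real.negMulLog ((uniform E).real (f ⁻¹' {(y : M)})) := by
    symm
    refine Fintype.sum_of_injective Subtype.val Subtype.val_injective _ _ ?_ fun _ => rfl
    intro y hy
    have : (f ⁻¹' {y} : Set E) = ∅ := by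
      ext ω
      simp only [Set.mem_preimage, Set.mem_singleton_iff, Set.mem_empty_iff_false, iff_false]
      exact fun h => hy ⟨⟨y, ω, h⟩, rfl⟩
    simp [this]
  rw [entropy, hsum, Finset.sum_congr rfl fun (y : LinearMap.range f) _ => by
    rw [uniform_real_linearMap f y.2], Finset.sum_const, nsmul_eq_mul, Finset.card_univ,
    card_eq_pow_finrank (K := F)]
  have hq0 : (Fintype.card F : ℝ) ^ finrank F (LinearMap.range f) ≠ 0 := by positivity
  simp only [Real.negMulLog, one_div, Real.log_inv, Real.log_pow, Nat.cast_pow]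
  field_simp

lemma entropy_linearMap_eq_sub (f : E →ₗ[F] M) :
    entropy (Fintype.card F) (uniform E) f = finrank F E - finrank F (LinearMap.ker f) := by
  rw [entropy_linearMap, eq_sub_iff_add_eq]
  exact_mod_cast f.finrank_range_add_finrank_ker

lemma entropy_linearMap_le (f : E →ₗ[F] M) :
    entropy (Fintype.card F) (uniform E) f ≤ finrank F M := by
  rw [entropy_linearMap]
  exact_mod_cast (LinearMap.range f).finrank_le

lemma entropy_linearMap_of_surjective (f : E →ₗ[F] M) (hf : Function.Surjective f) :
    entropy (Fintype.card F) (uniform E) f = finrank F M := by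
  rw [entropy_linearMap, LinearMap.range_eq_top.2 hf, finrank_top]

lemma condEntropy_linearMap_eq_zero (f : E →ₗ[F] M) (g : E →ₗ[F] M')
    (h : ∀ ω, g ω = 0 → f ω = 0) :
    condEntropy (Fintype.card F) (uniform E) f g = 0 := by
  have h1 : LinearMap.ker (f.prod g) = LinearMap.ker g := by
    rw [LinearMap.ker_prod]
    exact inf_eq_right.2 h
  rw [condEntropy, sub_eq_zero]
  refine (entropy_linearMap_eq_sub (f.prod g)).trans ?_
  rw [h1, entropy_linearMap_eq_sub]

/-- The hypothesis says that `ker (f, k) + ker (g, k) = ker k`. The dimension formula for this sum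
is the vanishing of the mutual information, as entropy is codimension of the kernel. -/
lemma condMutualInfo_linearMap_eq_zero (f : E →ₗ[F] M) (g : E →ₗ[F] M') (k : E →ₗ[F] M'')
    (h : ∀ ω, k ω = 0 → ∃ ω', k ω' = 0 ∧ f ω' = 0 ∧ g ω' = g ω) :
    condMutualInfo (Fintype.card F) (uniform E) f g k = 0 := by
  have e1 := entropy_linearMap_eq_sub (f.prod k)
  have e2 := entropy_linearMap_eq_sub k
  have e3 := entropy_linearMap_eq_sub (f.prod (g.prod k))
  have e4 := entropy_linearMap_eq_sub (g.prod k)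
  have hsup : LinearMap.ker (f.prod k) ⊔ LinearMap.ker (g.prod k) = LinearMap.ker k := by
    simp only [LinearMap.ker_prod]
    refine le_antisymm (sup_le inf_le_right inf_le_right) fun ω hω => ?_
    obtain ⟨ω', hk, hf, hg⟩ := h ω hω
    refine Submodule.mem_sup.2 ⟨ω', ⟨hf, hk⟩, ω - ω', ⟨?_, ?_⟩, by abel⟩
    · simp [hg]
    · simp [hk, LinearMap.mem_ker.1 hω]
  have hinf : LinearMap.ker (f.prod k) ⊓ LinearMap.ker (g.prod k)
      = LinearMap.ker (f.prod (g.prod k)) := by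
    simp only [LinearMap.ker_prod]
    exact le_antisymm (le_inf (inf_le_left.trans inf_le_left) inf_le_right)
      (le_inf (inf_le_inf_left _ inf_le_right) inf_le_right)
  have hdim := Submodule.finrank_sup_add_finrank_inf_eq (LinearMap.ker (f.prod k))
    (LinearMap.ker (g.prod k))
  rw [hsup, hinf] at hdim
  have hdim' : (finrank F (LinearMap.ker k) : ℝ) + finrank F (LinearMap.ker (f.prod (g.prod k)))
      = finrank F (LinearMap.ker (f.prod k)) + finrank F (LinearMap.ker (g.prod k)) := by
    exact_mod_cast hdim
  show (entropy _ _ (f.prod k) - entropy _ _ k)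
    - (entropy _ _ (f.prod (g.prod k)) - entropy _ _ (g.prod k)) = 0
  rw [e1, e2, e3, e4]
  linarith

/-- Linear functions of a uniform vector are independent if one of them takes all its values on the
kernel of the other. -/
lemma entropy_prod_linearMap (f : E →ₗ[F] M) (g : E →ₗ[F] M')
    (h : ∀ ω, ∃ ω', f ω' = 0 ∧ g ω' = g ω) :
    entropy (Fintype.card F) (uniform E) (fun ω => (f ω, g ω))
      = entropy (Fintype.card F) (uniform E) f + entropy (Fintype.card F) (uniform E) g := by
  have e1 := entropy_linearMap_eq_sub (f.prod g)
  have hsup : LinearMap.ker f ⊔ LinearMap.ker g = ⊤ := by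
    refine eq_top_iff.2 fun ω _ => ?_
    obtain ⟨ω', hf, hg⟩ := h ω
    exact Submodule.mem_sup.2 ⟨ω', hf, ω - ω', by simp [hg], by abel⟩
  have hdim := Submodule.finrank_sup_add_finrank_inf_eq (LinearMap.ker f) (LinearMap.ker g)
  rw [hsup, finrank_top, ← LinearMap.ker_prod] at hdim
  have hdim' : (finrank F E : ℝ) + finrank F (LinearMap.ker (f.prod g))
      = finrank F (LinearMap.ker f) + finrank F (LinearMap.ker g) := by exact_mod_cast hdim
  refine e1.trans ?_
  rw [entropy_linearMap_eq_sub, entropy_linearMap_eq_sub]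
  linarith

end LinearEntropy

/-! ### Interpolation by linearized polynomials -/

section LinearizedPolynomial

open Module Polynomial

variable {F K : Type} [Field F] [Fintype F] [Field K] [Algebra F K]

/-- The map `x ↦ ∑ k, a k * x ^ (q ^ k)` defined by a linearized polynomial, as a linear function of
the coefficients with values in the `F`-linear endomorphisms of `K`. -/
def linearizedEval (F K : Type) [Field F] [Fintype F] [Field K] [Algebra F K] (m : ℕ) :
    (Fin m → K) →ₗ[F] (K →ₗ[F] K) :=
  ∑ k : Fin m, (LinearMap.lcomp F K ((FiniteField.frobeniusAlgHom F K ^ (k : ℕ)).toLinearMap)) ∘ₗ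
    LinearMap.mul F K ∘ₗ LinearMap.proj k

lemma linearizedEval_apply {m : ℕ} (a : Fin m → K) (x : K) :
    linearizedEval F K m a x = ∑ k : Fin m, a k * x ^ Fintype.card F ^ (k : ℕ) := by
  simp [linearizedEval, LinearMap.sum_apply, FiniteField.coe_frobeniusAlgHom, pow_iterate]

/-- A linearized polynomial of `q`-degree less than the dimension of a subspace on which it vanishes
is zero. -/
lemma eq_zero_of_linearizedEval_eq_zero [Fintype K] (D : Submodule F K) (a : Fin (finrank F D) → K)
    (ha : ∀ x ∈ D, linearizedEval F K _ a x = 0) : a = 0 := by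
  classical
  have hq : 1 < Fintype.card F := Fintype.one_lt_card
  set p : K[X] := ∑ k : Fin (finrank F D), monomial (Fintype.card F ^ (k : ℕ)) (a k) with hp
  -- Exponents are at most `q ^ (d - 1)` with `d = finrank F D`, while `p` vanishes at the `q ^ d`
  -- points of `D`.
  have hdeg : p.degree < (Finset.univ.filter (· ∈ D) : Finset K).card := by
    have hc : (Finset.univ.filter (· ∈ D) : Finset K).card = Fintype.card F ^ finrank F D := by
      rw [← card_eq_pow_finrank (K := F) (V := D), Fintype.card_subtype]
    rw [hc, ← mem_degreeLT]
    refine Submodule.sum_mem _ fun k _ => mem_degreeLT.2 ?_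
    refine (degree_monomial_le _ _).trans_lt ?_
    exact_mod_cast Nat.pow_lt_pow_right hq k.2
  have hp0 : p = 0 := by
    refine eq_zero_of_degree_lt_of_eval_finset_eq_zero _ hdeg fun x hx => ?_
    rw [← ha x (by simpa using hx), linearizedEval_apply, hp, eval_finsetSum]
    simp
  funext k
  have hk : p.coeff (Fintype.card F ^ (k : ℕ)) = a k := by
    rw [hp, finsetSum_coeff, Finset.sum_eq_single k]
    · simp
    · intro j _ hj
      rw [coeff_monomial, if_neg]
      exact fun h => hj (Fin.ext (Nat.pow_right_injective hq h))
    · simp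
  rw [← hk, hp0]
  simp

/-- Linearized polynomials of `q`-degree less than `m` interpolate every linear map on a subspace of
dimension at most `m`. -/
lemma exists_linearizedEval_eq [Fintype K] {m : ℕ} (D : Submodule F K) (hD : finrank F D ≤ m)
    (ψ : K →ₗ[F] K) :
    ∃ a : Fin m → K, ∀ x ∈ D, linearizedEval F K m a x = ψ x := by
  let Φ : (Fin (finrank F D) → K) →ₗ[F] (D →ₗ[F] K) :=
    LinearMap.lcomp F K D.subtype ∘ₗ linearizedEval F K (finrank F D)
  have hΦ : ∀ a (x : D), Φ a x = linearizedEval F K _ a x := fun _ _ => rfl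
  have hinj : Function.Injective Φ := by
    rw [← LinearMap.ker_eq_bot, LinearMap.ker_eq_bot']
    intro a ha
    refine eq_zero_of_linearizedEval_eq_zero D a fun x hx => ?_
    rw [← hΦ a ⟨x, hx⟩, ha, LinearMap.zero_apply]
  -- Both spaces have dimension `finrank F D * finrank F K`, so uniqueness of the interpolant gives
  -- existence.
  have hrank : finrank F (Fin (finrank F D) → K) = finrank F (D →ₗ[F] K) := by
    rw [finrank_linearMap, finrank_pi_fintype]
    simp
  obtain ⟨a, ha⟩ := (LinearMap.injective_iff_surjective_of_finrank_eq_finrank hrank).1 hinj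
    (ψ ∘ₗ D.subtype)
  -- The interpolant has `finrank F D` coefficients and is padded with zeros up to `m`.
  refine ⟨Function.extend (Fin.castLE hD) a 0, fun x hx => ?_⟩
  have h1 : linearizedEval F K _ a x = ψ x := by
    rw [← hΦ a ⟨x, hx⟩, ha]
    rfl
  rw [← h1, linearizedEval_apply, linearizedEval_apply]
  symm
  have hi := Fin.castLE_injective hD
  refine Fintype.sum_of_injective (Fin.castLE hD) hi _ _ (fun i hi' => ?_) fun i => ?_
  · rw [Function.extend_apply' _ _ _ hi']
    simp
  · rw [hi.extend_apply]
    rfl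

/-- A family in `K` whose only linear relation over `F` is that its sum vanishes. -/
lemma exists_sum_eq_zero_generic {F K I : Type} [Field F] [Field K] [Algebra F K]
    [FiniteDimensional F K] [Fintype I] (hI : finrank F K + 1 = Fintype.card I) :
    ∃ α : I → K, ∑ i, α i = 0 ∧
      ∀ w : I → K, ∑ i, w i = 0 → ∃ ψ : K →ₗ[F] K, ∀ i, ψ (α i) = w i := by
  classical
  obtain ⟨i₀⟩ : Nonempty I := Fintype.card_pos_iff.1 (by omega)
  have hc : Fintype.card {i // i ≠ i₀} = finrank F K := by
    rw [Fintype.card_subtype_compl]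
    simp
    omega
  -- All points but one form a basis, and the last is minus their sum. A linear map may then be
  -- prescribed on the basis, and `∑ w i = 0` makes its value at the last point correct.
  let b : Basis {i // i ≠ i₀} F K :=
    (finBasis F K).reindex (Fintype.equivFinOfCardEq hc).symm
  have hsplit : ∀ f : I → K, ∑ i, f i = f i₀ + ∑ i : {i // i ≠ i₀}, f i := fun f =>
    Fintype.sum_eq_add_sum_subtype_ne f i₀
  refine ⟨fun i => if h : i ≠ i₀ then b ⟨i, h⟩ else -∑ j, b j, ?_, fun w hw => ?_⟩
  · rw [hsplit, dif_neg (by simp), Finset.sum_congr rfl fun (i : {i // i ≠ i₀}) _ => dif_pos i.2]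
    simp
  · refine ⟨b.constr F fun i => w i, fun i => ?_⟩
    by_cases h : i ≠ i₀
    · simp [h]
    · simp only [dif_neg h, map_neg, map_sum]
      simp only [Basis.constr_basis]
      rw [hsplit] at hw
      rw [not_not.1 h]
      exact (eq_neg_of_add_eq_zero_left hw).symm

end LinearizedPolynomial

/-! ### The linear scheme and its security -/

section Scheme

open Module

variable {F K : Type} [Field F] [Fintype F] [Field K] [Algebra F K] {U V L m : ℕ}

/-- Sample space of the linear scheme: all inputs, and the coefficients of a linearized polynomial,
which form the source key. -/
abbrev Sample (F K : Type) (U V L m : ℕ) : Type :=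
  (Fin U × Fin V → Fin L → F) × (Fin m → K)

/-- The input of user `i`. -/
def inputMap (F K : Type) [Field F] [Field K] [Algebra F K] {U V : ℕ} (L m : ℕ)
    (i : Fin U × Fin V) : Sample F K U V L m →ₗ[F] (Fin L → F) :=
  LinearMap.proj i ∘ₗ LinearMap.fst F _ _

/-- The key at a point `x` of `K`: the value at `x` of the linearized polynomial. -/
def keyMap (F : Type) {K : Type} [Field F] [Fintype F] [Field K] [Algebra F K] (U V L m : ℕ)
    (x : K) : Sample F K U V L m →ₗ[F] K :=
  (linearizedEval F K m).flip x ∘ₗ LinearMap.snd F _ _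

/-- The message of user `i`: the input masked by the key. -/
def messageMap (e : (Fin L → F) ≃ₗ[F] K) (α : Fin U × Fin V → K) (m : ℕ) (i : Fin U × Fin V) :
    Sample F K U V L m →ₗ[F] K :=
  e.toLinearMap ∘ₗ inputMap F K L m i + keyMap F U V L m (α i)

/-- The message of relay `u`: the sum of the messages it receives. -/
def relayMap (e : (Fin L → F) ≃ₗ[F] K) (α : Fin U × Fin V → K) (m : ℕ) (u : Fin U) :
    Sample F K U V L m →ₗ[F] K :=
  ∑ v, messageMap e α m (u, v)

lemma inputMap_apply {F K : Type} [Field F] [Field K] [Algebra F K] (i : Fin U × Fin V)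
    (ω : Sample F K U V L m) :
    inputMap F K L m i ω = ω.1 i := rfl

lemma keyMap_apply (x : K) (ω : Sample F K U V L m) :
    keyMap F U V L m x ω = linearizedEval F K m ω.2 x := rfl

lemma messageMap_apply (e : (Fin L → F) ≃ₗ[F] K) (α : Fin U × Fin V → K) (i : Fin U × Fin V)
    (ω : Sample F K U V L m) :
    messageMap e α m i ω = e (ω.1 i) + linearizedEval F K m ω.2 (α i) := rfl

lemma relayMap_apply (e : (Fin L → F) ≃ₗ[F] K) (α : Fin U × Fin V → K) (u : Fin U)
    (ω : Sample F K U V L m) :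
    relayMap e α m u ω
      = e (∑ v, ω.1 (u, v)) + linearizedEval F K m ω.2 (∑ v, α (u, v)) := by
  simp [relayMap, LinearMap.sum_apply, messageMap_apply, Finset.sum_add_distrib]

/-- The linear scheme over the extension field `K` with evaluation points `α`. -/
def linearNetwork [Fintype K] (e : (Fin L → F) ≃ₗ[F] K) (α : Fin U × Fin V → K) (m : ℕ) :
    Network F U V L where
  Ω := Sample F K U V L m
  mΩ := ⊤
  P := @uniform _ ⊤
  prob := @isProbabilityMeasure_uniform _ ⊤ (@DiscreteMeasurableSpace.mk _ ⊤ fun _ => trivial) _ _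
  AZS := Fin m → K
  AZ := K
  AX := K
  AY := K
  W i := inputMap F K L m i
  ZS := LinearMap.snd F _ _
  Z i := keyMap F U V L m (α i)
  X i := messageMap e α m i
  Y u := relayMap e α m u
  meas_W _ := fun _ _ => trivial
  meas_ZS := fun _ _ => trivial
  meas_Z _ := fun _ _ => trivial
  meas_X _ := fun _ _ => trivial
  meas_Y _ := fun _ _ => trivial

section

variable (e : (Fin L → F) ≃ₗ[F] K) (α : Fin U × Fin V → K)

/-- All inputs, as a linear map. -/
def allInputMap (F K : Type) [Field F] [Field K] [Algebra F K] (U V L m : ℕ) :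
    Sample F K U V L m →ₗ[F] (Fin U × Fin V → Fin L → F) :=
  LinearMap.pi fun i => inputMap F K L m i

/-- What the users in `C` know, as a linear map. -/
def collusionMap (L m : ℕ) (C : Finset (Fin U × Fin V)) :
    Sample F K U V L m →ₗ[F] (C → (Fin L → F) × K) :=
  LinearMap.pi fun i => (inputMap F K L m i.1).prod (keyMap F U V L m (α i))

lemma collusionMap_eq_zero_iff {C : Finset (Fin U × Fin V)} {ω : Sample F K U V L m} :
    collusionMap α L m C ω = 0 ↔ ∀ i ∈ C, ω.1 i = 0 ∧ linearizedEval F K m ω.2 (α i) = 0 := by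
  rw [funext_iff]
  simp [collusionMap, inputMap_apply, keyMap_apply]

/-- The sum of the inputs, as a linear map. -/
def sumMap (F K : Type) [Field F] [Field K] [Algebra F K] (U V L m : ℕ) :
    Sample F K U V L m →ₗ[F] (Fin L → F) :=
  ∑ i, inputMap F K L m i

lemma sumMap_apply {F K : Type} [Field F] [Field K] [Algebra F K] (ω : Sample F K U V L m) :
    sumMap F K U V L m ω = ∑ i, ω.1 i := by
  simp [sumMap, LinearMap.sum_apply, inputMap_apply]

lemma sumW_linearNetwork [Fintype K] :
    (linearNetwork e α m).sumW = sumMap F K U V L m :=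
  funext fun ω => (sumMap_apply ω).symm

end

/-- The linear scheme is secure if its points have no linear relation over `F` but the vanishing of
their sum, and the linearized polynomials have enough coefficients. -/
theorem isSecureScheme_linearNetwork [Fintype K] {T : ℕ} (hU : 1 ≤ U) (e : (Fin L → F) ≃ₗ[F] K)
    {α : Fin U × Fin V → K} (hα : ∑ i, α i = 0)
    (hψ : ∀ w : Fin U × Fin V → K, ∑ i, w i = 0 → ∃ ψ : K →ₗ[F] K, ∀ i, ψ (α i) = w i)
    (hT : V + T < U * V) (hm : V + T ≤ m) (hm' : min L (U + T - 1) ≤ m) :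
    (linearNetwork e α m).IsSecureScheme T := by
  classical
  let _ : MeasurableSpace (Sample F K U V L m) := ⊤
  have _ : DiscreteMeasurableSpace (Sample F K U V L m) := ⟨fun _ => trivial⟩
  have hsurj : ∀ i, Function.Surjective (inputMap F K (U := U) (V := V) L m i) := fun i w =>
    ⟨(fun _ => w, 0), rfl⟩
  refine ⟨?_, ?_, ?_, ?_, ?_, ?_, ?_, ?_⟩
  · intro i w
    have h1 := uniform_real_linearMap (inputMap F K (U := U) (V := V) L m i) (x := w) (hsurj i w)
    rw [LinearMap.range_eq_top.2 (hsurj i), finrank_top] at h1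
    rw [finrank_pi, Fintype.card_fin] at h1
    exact h1
  · have h1 := entropy_prod_linearMap
      (LinearMap.pi fun i => keyMap F U V L m (α i)) (allInputMap F K U V L m) (fun ω =>
        ⟨(ω.1, 0), by ext i; simp [keyMap_apply], rfl⟩)
    refine h1.trans (congrArg _ ?_)
    rw [entropy_linearMap_of_surjective _ fun w => ⟨(w, 0), rfl⟩]
    have h2 : ∀ i, (linearNetwork e α m).H ((linearNetwork e α m).W i) = L := fun i =>
      (entropy_linearMap_of_surjective _ (hsurj i)).trans (by simp)
    simp [h2, finrank_pi_fintype]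
  · refine condEntropy_linearMap_eq_zero (LinearMap.pi fun i => keyMap F U V L m (α i))
      (LinearMap.snd F (Fin U × Fin V → Fin L → F) (Fin m → K)) fun ω hω => ?_
    ext i
    simp only [LinearMap.snd_apply] at hω
    simp [keyMap_apply, hω]
  · intro i
    refine condEntropy_linearMap_eq_zero (messageMap e α m i)
      ((inputMap F K L m i).prod (keyMap F U V L m (α i))) fun ω hω => ?_
    obtain ⟨hW, hZ⟩ := Prod.mk.inj hω
    rw [inputMap_apply] at hW
    rw [keyMap_apply] at hZ
    simp [messageMap_apply, hW, hZ]
  · intro u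
    refine condEntropy_linearMap_eq_zero (relayMap e α m u)
      (LinearMap.pi fun v => messageMap e α m (u, v)) fun ω hω => ?_
    rw [funext_iff] at hω
    simp only [relayMap, LinearMap.sum_apply]
    exact Finset.sum_eq_zero fun v _ => hω v
  · rw [sumW_linearNetwork]
    refine condEntropy_linearMap_eq_zero (sumMap F K U V L m)
      (LinearMap.pi fun u => relayMap e α m u) fun ω hω => ?_
    have h1 : ∑ u, relayMap e α m u ω = 0 := Finset.sum_eq_zero fun u _ => congrFun hω u
    simp only [relayMap_apply, Finset.sum_add_distrib, ← map_sum, ← Fintype.sum_prod_type', hα,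
      map_zero, add_zero, EmbeddingLike.map_eq_zero_iff] at h1
    rw [sumMap_apply, ← h1]
  · intro u C hC
    refine condMutualInfo_linearMap_eq_zero (LinearMap.pi fun v => messageMap e α m (u, v))
      (allInputMap F K U V L m) (collusionMap α L m C) fun ω hω => ?_
    rw [collusionMap_eq_zero_iff] at hω
    -- The users whose keys affect what relay `u` and the colluders see. As `V + T < UV`, some `j`
    -- is outside `Q`; its prescribed value absorbs the total so that the values sum to zero, as
    -- `hψ` requires.
    set Q : Finset (Fin U × Fin V) := C ∪ {u} ×ˢ Finset.univ with hQ
    have hQc : Q.card ≤ V + T := by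
      refine (Finset.card_union_le _ _).trans ?_
      simp
      omega
    obtain ⟨j, hj⟩ : ∃ j, j ∉ Q := by
      by_contra h
      push Not at h
      have : Q = Finset.univ := Finset.eq_univ_iff_forall.2 h
      rw [this, Finset.card_univ] at hQc
      simp at hQc
      omega
    obtain ⟨ψ, hψ'⟩ := hψ (fun i => (if i ∈ Q then -e (ω.1 i) else 0)
      + if i = j then ∑ i ∈ Q, e (ω.1 i) else 0) (by
        rw [Finset.sum_add_distrib]
        simp)
    obtain ⟨a, ha⟩ := exists_linearizedEval_eq (m := m)
      (Submodule.span F ((Q.image α : Finset K) : Set K))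
      ((finrank_span_finset_le_card (R := F) (Q.image α)).trans
        (Finset.card_image_le.trans (hQc.trans hm))) ψ
    have hval : ∀ i ∈ Q, linearizedEval F K m a (α i) = -e (ω.1 i) := by
      intro i hi
      rw [ha _ (Submodule.subset_span (by
        simpa using ⟨i.1, i.2, hi, rfl⟩)), hψ', if_pos hi, if_neg, add_zero]
      rintro rfl
      exact hj hi
    -- The inputs stay, and the new polynomial takes the value `-e (ω.1 i)` at each point of `Q`,
    -- cancelling the inputs in every message seen.
    refine ⟨(ω.1, a), ?_, ?_, rfl⟩
    · rw [collusionMap_eq_zero_iff]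
      intro i hi
      refine ⟨(hω i hi).1, ?_⟩
      rw [hval i (Finset.mem_union_left _ hi), (hω i hi).1]
      simp
    · ext v
      simp [messageMap_apply, hval (u, v) (by simp [hQ])]
  · intro C hC
    rw [sumW_linearNetwork]
    refine condMutualInfo_linearMap_eq_zero (LinearMap.pi fun u => relayMap e α m u)
      (allInputMap F K U V L m) ((sumMap F K U V L m).prod (collusionMap α L m C)) fun ω hω => ?_
    obtain ⟨hsum, hω⟩ := Prod.mk.inj hω
    replace hω := (collusionMap_eq_zero_iff α).1 hω
    rw [sumMap_apply] at hsum
    -- No spare user is needed here: conditioning on the sum makes these values sum to zero.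
    obtain ⟨ψ, hψ'⟩ := hψ (fun i => -e (ω.1 i)) (by
      rw [Finset.sum_neg_distrib, ← map_sum, hsum]
      simp)
    let u₀ : Fin U := ⟨0, hU⟩
    let β : Fin U → K := fun u => ∑ v, α (u, v)
    -- The server sees the polynomial only at the relay points `β u`. They sum to zero, so `β u₀`
    -- may be omitted, which leaves at most `U + T - 1` points; the span also has dimension at most
    -- `finrank F K = L`.
    let G : Finset K := C.image α ∪ (Finset.univ.erase u₀).image β
    have hG : finrank F (Submodule.span F (G : Set K)) ≤ m := by
      refine le_trans (le_min ?_ ?_) hm'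
      · exact (Submodule.finrank_le _).trans (by simp [← e.finrank_eq])
      · refine (finrank_span_finset_le_card (R := F) G).trans ((Finset.card_union_le _ _).trans ?_)
        have h1 : (C.image α).card ≤ C.card := Finset.card_image_le
        have h2 : ((Finset.univ.erase u₀).image β).card ≤ U - 1 :=
          Finset.card_image_le.trans (by simp)
        omega
    obtain ⟨a, ha⟩ := exists_linearizedEval_eq (m := m) (Submodule.span F (G : Set K)) hG ψ
    have hβ : ∀ u ≠ u₀, β u ∈ Submodule.span F (G : Set K) := fun u hu =>
      Submodule.subset_span (Finset.mem_union_right _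
        (Finset.mem_image_of_mem _ (Finset.mem_erase.2 ⟨hu, Finset.mem_univ _⟩)))
    have hβ' : ∀ u, β u ∈ Submodule.span F (G : Set K) := by
      intro u
      by_cases hu : u = u₀
      · have h0 : ∑ u, β u = 0 := by
          rw [← hα]
          exact (Fintype.sum_prod_type _).symm
        rw [← Finset.add_sum_erase _ _ (Finset.mem_univ u₀)] at h0
        rw [hu, eq_neg_of_add_eq_zero_left h0]
        exact Submodule.neg_mem _ (Submodule.sum_mem _ fun u hu => hβ u (Finset.ne_of_mem_erase hu))
      · exact hβ u hu
    refine ⟨(ω.1, a), ?_, ?_, rfl⟩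
    · refine Prod.ext ((sumMap_apply _).trans hsum)
        ((collusionMap_eq_zero_iff α).2 fun i hi => ⟨(hω i hi).1, ?_⟩)
      rw [ha _ (Submodule.subset_span (Finset.mem_union_left _ (Finset.mem_image_of_mem _ hi))),
        hψ', (hω i hi).1]
      simp
    · ext u
      simp only [LinearMap.pi_apply, relayMap_apply, Pi.zero_apply]
      rw [show ∑ v, α (u, v) = β u from rfl, ha _ (hβ' u)]
      simp [β, hψ']

end Scheme

/-! ### Achievability and the rate region -/

/-- Every finite field has an extension of each positive degree. -/
lemma exists_field_extension (F : Type) [Field F] [Fintype F] {n : ℕ} (hn : n ≠ 0) :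
    ∃ (K : Type) (_ : Field K) (_ : Algebra F K) (_ : Fintype K), Module.finrank F K = n := by
  obtain ⟨p, hp⟩ := CharP.exists F
  have : Fact p.Prime := ⟨CharP.char_is_prime F p⟩
  have : NeZero n := ⟨hn⟩
  exact ⟨FiniteField.Extension F p n, inferInstance, inferInstance, Fintype.ofFinite _,
    FiniteField.finrank_extension F p n⟩

/-- One scheme, of input length `UV - 1`, attains the corner point of the region, which every other
tuple dominates. Hence the region is achieved without taking limits. -/
theorem achievable_of_bounds (F : Type) [Field F] [Fintype F] {U V T : ℕ} (hU : 2 ≤ U) (hV : 1 ≤ V)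
    (hT : T < (U - 1) * V) {R : ℝ × ℝ × ℝ × ℝ} (hX : 1 ≤ R.1) (hY : 1 ≤ R.2.1) (hZ : 1 ≤ R.2.2.1)
    (hZS : max ((V : ℝ) + T) (min ((U : ℝ) * V - 1) ((U : ℝ) + T - 1)) ≤ R.2.2.2) :
    Achievable F U V T R := by
  have hUV : V + T < U * V := by
    obtain ⟨U, rfl⟩ : ∃ k, U = k + 1 := ⟨U - 1, by omega⟩
    rw [Nat.add_sub_cancel] at hT
    rw [add_mul]
    omega
  -- `UV` points with a single linear relation span dimension `UV - 1`. Messages and keys in `K`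
  -- then have as many symbols as an input, hence rate at most 1.
  obtain ⟨K, _, _, _, hK⟩ := exists_field_extension F (n := U * V - 1) (by omega)
  obtain ⟨α, hα, hψ⟩ := exists_sum_eq_zero_generic (F := F) (K := K) (I := Fin U × Fin V)
    (by rw [hK]; simp; omega)
  let e : (Fin (U * V - 1) → F) ≃ₗ[F] K := LinearEquiv.ofFinrankEq _ _ (by simp [hK])
  let m := max (V + T) (min (U * V - 1) (U + T - 1))
  have hm : (m : ℝ) ≤ R.2.2.2 := by
    refine le_trans (le_of_eq ?_) hZS
    simp only [m, Nat.cast_max, Nat.cast_min, Nat.cast_add]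
    rw [Nat.cast_sub (by omega), Nat.cast_sub (by omega)]
    push_cast
    rfl
  have hL : (0 : ℝ) < (U * V - 1 : ℕ) := by exact_mod_cast (by omega : 0 < U * V - 1)
  have hone : ∀ {r x : ℝ}, 1 ≤ r → x ≤ (U * V - 1 : ℕ) → x / (U * V - 1 : ℕ) ≤ r := fun hr hx =>
    ((div_le_one hL).2 hx).trans hr
  let _ : MeasurableSpace (Sample F K U V (U * V - 1) m) := ⊤
  have _ : DiscreteMeasurableSpace (Sample F K U V (U * V - 1) m) := ⟨fun _ => trivial⟩
  refine ⟨U * V - 1, by omega, linearNetwork e α m,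
    isSecureScheme_linearNetwork (by omega) e hα hψ hUV (le_max_left _ _) (le_max_right _ _),
    fun i => hone hX ?_, fun u => hone hY ?_, fun i => hone hZ ?_, le_trans ?_ hm⟩
  · exact (entropy_linearMap_le (messageMap e α m i)).trans (by rw [hK])
  · exact (entropy_linearMap_le (relayMap e α m u)).trans (by rw [hK])
  · exact (entropy_linearMap_le (keyMap F U V (U * V - 1) m (α i))).trans (by rw [hK])
  · rw [div_le_iff₀ hL]
    refine (entropy_linearMap_le (LinearMap.snd F (Fin U × Fin V → Fin (U * V - 1) → F)
      (Fin m → K))).trans ?_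
    rw [Module.finrank_pi_fintype]
    simp [hK]

/-- The region of the rate tuples that satisfy the four bounds is closed. -/
lemma isClosed_bounds (c : ℝ) :
    IsClosed {R : ℝ × ℝ × ℝ × ℝ | 1 ≤ R.1 ∧ 1 ≤ R.2.1 ∧ 1 ≤ R.2.2.1 ∧ c ≤ R.2.2.2} := by
  simp only [Set.ofPred_and]
  refine IsClosed.inter ?_ (IsClosed.inter ?_ (IsClosed.inter ?_ ?_)) <;>
  exact isClosed_le continuous_const (by fun_prop)

end

end HSA

theorem theorem1 (F : Type) [Field F] [Fintype F] (U V T : ℕ) (hU : 2 ≤ U) (hV : 1 ≤ V) :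
    ((U - 1) * V ≤ T → HSA.optimalRateRegion F U V T = ∅) ∧
    (T < (U - 1) * V → HSA.optimalRateRegion F U V T =
      {R : ℝ × ℝ × ℝ × ℝ | 1 ≤ R.1 ∧ 1 ≤ R.2.1 ∧ 1 ≤ R.2.2.1 ∧
        max ((V : ℝ) + T) (min ((U : ℝ) * V - 1) ((U : ℝ) + T - 1)) ≤ R.2.2.2}) := by
  refine ⟨fun hT => ?_, fun hT => Set.Subset.antisymm ?_ ?_⟩
  · rw [HSA.optimalRateRegion, closure_empty_iff, Set.eq_empty_iff_forall_notMem]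
    exact fun R hR => hT.not_gt (HSA.Achievable.lt hU hV hR)
  · exact closure_minimal (fun R hR => HSA.Achievable.bounds hU hV hR) (HSA.isClosed_bounds _)
  · exact fun R hR =>
      subset_closure (HSA.achievable_of_bounds F hU hV hT hR.1 hR.2.1 hR.2.2.1 hR.2.2.2)
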